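/- Let $p,q\ge 1$ be coprime integers with $\frac pq<\frac12$, and write $q=mp+r$ with $m=\lfloor q/p\rfloor$ and $0\le r<p$ (so $r\ge 1$ as soon as $p\ge 2$). A billiard ball moves along straight chords in a disc of radius $R>0$ and is reflected elastically at the boundary circle; let $X_0=P_0,X_1,X_2,\dots$ be its consecutive boundary points, where $X_1$ is obtained from $X_0$ by the counterclockwise rotation by $\vartheta=\frac pq\cdot 2\pi$ about the centre. Let $f_n$ be the number of regions (connected components) into which the open disc is divided by the first $n$ chords $X_0X_1,\dots,X_{n-1}X_n$. We say that the chord $X_nX_{n+1}$ passes $P_0$ if $P_0$ lies strictly inside the counterclockwise arc of angle $\vartheta$ from $X_n$ to $X_{n+1}$. Put $N_k=km+\lfloor kr/p\rfloor$ for $1\le k\le p$, so that $N_1=m$ and $N_p=q$. Then: 1. $X_n=P_0$ if and only if $q\mid n$. Among the chords $X_nX_{n+1}$ with $0\le n<q$, exactly those with $n=N_k$, $1\le k\le p-1$, pass $P_0$. Moreover $0\le\lfloor kr/p\rfloor\le r-1$ for $1\le k\le p-1$. 2. $f_0=1$. The chords of the first block, $0\le n<N_1=m$ (there are $m$ of them),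 cross no earlier chord, and $f_{n+1}=f_n+1$. For $1\le k\le p-1$, the chord with $n=N_k$ crosses $2k-1$ earlier chords inside the disc, and $f_{N_k+1}=f_{N_k}+2k$. For $2\le k\le p$, the $k$-th block of chords, $N_{k-1}+1\le n<N_k$, has length $m-1+\lfloor kr/p\rfloor-\lfloor (k-1)r/p\rfloor$; each of its chords crosses $2k-2$ earlier chords inside the disc, and $f_{n+1}=f_n+(2k-1)$. In particular $f_m=m+1$ and, if $p\ge2$, $f_{m+1}=m+3$ and $f_{2m+\lfloor 2r/p\rfloor}=m+3+3\left(m-1+\lfloor 2r/p\rfloor-\lfloor r/p\rfloor\right)$. 3. The total number of regions is $$f_q=1+\sum_{n=1}^{m+\lfloor r/p\rfloor}1+\sum_{k=2}^{p}\left(2(k-1)+\sum_{n=(k-1)m+2+\lfloor (k-1)r/p\rfloor}^{km+\lfloor kr/p\rfloor}(2k-1)\right)=pq+1 .$$ 4. If $r=1$, then $\lfloor k/p\rfloor=0$ for $1\le k\le p-1$, and the chords $X_nX_{n+1}$, $0\le n<q$, passing $P_0$ are those with $n=km$, $1\le k\le p-1$. The sequence $f_n$ then increases by $1$ ($m$ times),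 by $2$ (once), by $3$ ($m-1$ times), by $4$ (once), by $5$ ($m-1$ times), and so on: for $1\le k\le p-1$ the one step by $2k$ is $f_{km+1}=f_{km}+2k$, the block of steps by $2k-1$ has length $m-1$ for $2\le k\le p-1$, and the sequence ends with steps by $2p-1$ ($m$ times). If $p\ge3$, then $f_{2m}=4m$ and $f_{2m+1}=4m+4$. Moreover $$f_q=1+\sum_{n=1}^{m}1+\sum_{k=2}^{p-1}\left(2(k-1)+\sum_{n=(k-1)m+2}^{km}(2k-1)\right)+2(p-1)+\sum_{n=(p-1)m+2}^{pm+1}(2p-1).$$ -/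

import Mathlib

/-- `X 0, X 1, X 2, …` are the consecutive points at which a billiard ball hits the boundary of the
disc of radius `R` about the origin of the plane `ℂ`, when the first two points form the
(counterclockwise) central angle `θ`. At each boundary point the incoming direction is reflected
elastically: it is mirrored in the tangent line, which is the orthogonal complement of the radius. -/
structure IsBilliardTrajectory (R θ : ℝ) (X : ℕ → ℂ) : Prop where
  mem_circle : ∀ n, X n ∈ Metric.sphere (0 : ℂ) R
  first_angle : X 1 = Complex.exp ((θ : ℂ) * Complex.I) * X 0
  step_ne : ∀ n, X (n + 1) ≠ X n
  elastic : ∀ n, SameRay ℝ (X (n + 2) - X (n + 1))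
    ((Submodule.span ℝ {X (n + 1)})ᗮ.reflection (X (n + 1) - X n))

/-- The part of the open disc not covered by the first `n` chords of the trajectory. -/
def uncovered (R : ℝ) (X : ℕ → ℂ) (n : ℕ) : Set ℂ :=
  Metric.ball (0 : ℂ) R \ ⋃ j ∈ Finset.range n, segment ℝ (X j) (X (j + 1))

/-- The number of regions into which the disc is divided by the first `n` chords: the number of
connected components of the uncovered part. -/
noncomputable def regionCount (R : ℝ) (X : ℕ → ℂ) (n : ℕ) : ℕ :=
  Set.ncard {U : Set ℂ | ∃ z ∈ uncovered R X n, U = connectedComponentIn (uncovered R X n) z}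

/-- The number of earlier chords that the chord from `X n` to `X (n + 1)` crosses inside the
disc. -/
noncomputable def crossedChords (X : ℕ → ℂ) (n : ℕ) : ℕ :=
  Set.ncard {j : ℕ | j < n ∧
    (openSegment ℝ (X j) (X (j + 1)) ∩ openSegment ℝ (X n) (X (n + 1))).Nonempty}

/-- The step from `X n` to `X (n + 1)` (a turn by `θ`) passes the boundary point `A`: the point `A`
lies strictly inside the arc that is swept counterclockwise from `X n` by the angle `θ`. -/
def PassesOver (θ : ℝ) (X : ℕ → ℂ) (n : ℕ) (A : ℂ) : Prop :=
  ∃ s ∈ Set.Ioo (0 : ℝ) θ, A = Complex.exp ((s : ℂ) * Complex.I) * X n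

/-- `k * m + ⌊k * r / p⌋` (the division is that of natural numbers, which rounds down). -/
def roundEnd (p m r k : ℕ) : ℕ := k * m + k * r / p

/-!
The trajectory is the orbit of a rotation: reflecting the incoming chord in the tangent turns it by
the central angle `θ`, so `X n = exp (i n θ) X 0` (`IsBilliardTrajectory.succ_eq`), and the `j`-th
chord is the part inside the disc of the line with unit normal `exp (i (j + 1/2) θ) X 0 / R` at
distance `R cos (θ / 2)` from the centre.

*Regions.* The components of a convex open set off finitely many walls are the convex cells given by
the sign vectors (`ncard_components_eq`). Inserting a wall adds as many cells as there are old cells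
that it meets (`ncard_posWalls_insert`). These are counted by the pieces into which the old walls
divide the new one, and the same lemma, applied on an interval, shows that there is one piece more
than there are crossings (`ncard_posWalls_insert_segment`), provided that the crossings are distinct.
They are, because all lines have the same distance from the centre: their normals `u` through a given
point satisfy a quadratic equation (`eq_or_eq_of_inner_eq`). Hence each of the first `q` chords adds
one region more than the number of earlier chords that it crosses
(`IsBilliardTrajectory.regionCount_succ`).

*Crossings.* Two lines at distance `R cos (θ / 2)` whose normals form the angle `α` meet inside the
disc exactly if `cos θ < cos α`. For `θ = 2 π p / q` and chords that are `i` steps apart this says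
that `i p` is at distance less than `p` from a multiple `k q`, that is, `i = N k` or `i = N k + 1`
with `1 ≤ k < p`, where `N k = ⌊k q / p⌋` are the passages of the initial point
(`cos_angle_lt_iff_roundEnd`). So the `n`-th chord crosses as many earlier chords as there are `k`
with `N k ≤ n` plus as many as there are `k` with `N k < n`
(`IsBilliardTrajectory.crossedChords_eq`).

*Total.* Summation by parts expresses the sum of the increments by `∑ N k`
(`apply_add_two_mul_sum_of_blocks`), and the symmetry `N k + N (p - k) = q - 1` evaluates it.
-/

/-! ### Cells of a finite arrangement of walls in a convex open set -/

section Arrangement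

variable {ι E : Type*} [NormedAddCommGroup E] [NormedSpace ℝ E]

/-- The points that lie on none of the walls `φ j = c j`, `j ∈ J`. -/
def offWalls (φ : ι → E →L[ℝ] ℝ) (c : ι → ℝ) (J : Finset ι) : Set E :=
  {z | ∀ j ∈ J, φ j z ≠ c j}

/-- The sign vector of a point with respect to the walls `φ j = c j`, `j ∈ J`, encoded as the set of
those walls on whose positive side the point lies. -/
noncomputable def posWalls (φ : ι → E →L[ℝ] ℝ) (c : ι → ℝ) (J : Finset ι) (z : E) : Finset ι :=
  J.filter fun j => c j < φ j z

variable {φ : ι → E →L[ℝ] ℝ} {c : ι → ℝ} {J : Finset ι} {V : Set E}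

theorem posWalls_eq_iff {z w : E} :
    posWalls φ c J z = posWalls φ c J w ↔ ∀ j ∈ J, (c j < φ j z ↔ c j < φ j w) := by
  simp only [posWalls, Finset.ext_iff, Finset.mem_filter]
  constructor
  · intro h j hj
    simpa [hj] using h j
  · intro h j
    by_cases hj : j ∈ J <;> simp [hj, h]

theorem finite_image_posWalls (S : Set E) : (posWalls φ c J '' S).Finite := by
  refine (Finset.finite_toSet J.powerset).subset ?_
  rintro _ ⟨z, -, rfl⟩
  exact Finset.mem_coe.2 (Finset.mem_powerset.2 (Finset.filter_subset _ _))

theorem convex_cell (hV : Convex ℝ V) (z : E) :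
    Convex ℝ {w | w ∈ V ∩ offWalls φ c J ∧ posWalls φ c J w = posWalls φ c J z} := by
  rintro w₁ ⟨⟨h₁, ho₁⟩, hs₁⟩ w₂ ⟨⟨h₂, ho₂⟩, hs₂⟩ a b ha hb hab
  rw [posWalls_eq_iff] at hs₁ hs₂
  have key : ∀ j ∈ J, φ j (a • w₁ + b • w₂) ≠ c j ∧
      (c j < φ j (a • w₁ + b • w₂) ↔ c j < φ j z) := by
    intro j hj
    have e : φ j (a • w₁ + b • w₂) - c j = a * (φ j w₁ - c j) + b * (φ j w₂ - c j) := by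
      simp only [map_add, map_smul, smul_eq_mul]
      linear_combination c j * hab
    have pos_or : 0 < a ∨ 0 < b := by
      by_contra! h
      linarith
    by_cases hz : c j < φ j z
    · have k₁ := sub_pos.2 ((hs₁ j hj).2 hz)
      have k₂ := sub_pos.2 ((hs₂ j hj).2 hz)
      have : 0 < a * (φ j w₁ - c j) + b * (φ j w₂ - c j) := by
        rcases pos_or with h | h <;> positivity
      exact ⟨by intro h; linarith, by simp only [hz, iff_true]; linarith⟩
    · have k₁ : 0 < c j - φ j w₁ :=
        sub_pos.2 (lt_of_le_of_ne (not_lt.1 fun h => hz ((hs₁ j hj).1 h)) (ho₁ j hj))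
      have k₂ : 0 < c j - φ j w₂ :=
        sub_pos.2 (lt_of_le_of_ne (not_lt.1 fun h => hz ((hs₂ j hj).1 h)) (ho₂ j hj))
      have : 0 < a * (c j - φ j w₁) + b * (c j - φ j w₂) := by
        rcases pos_or with h | h <;> positivity
      exact ⟨by intro h; linarith, by simp only [hz, iff_false]; linarith⟩
  exact ⟨⟨hV h₁ h₂ ha hb hab, fun j hj => (key j hj).1⟩,
    posWalls_eq_iff.2 fun j hj => (key j hj).2⟩

theorem eventually_mem_cell (hV : IsOpen V) {z : E} (hz : z ∈ V) (ho : z ∈ offWalls φ c J) :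
    ∀ᶠ w in nhds z, (w ∈ V ∧ w ∈ offWalls φ c J) ∧ posWalls φ c J w = posWalls φ c J z := by
  have h : ∀ j ∈ J, ∀ᶠ w in nhds z, φ j w ≠ c j ∧ (c j < φ j w ↔ c j < φ j z) := by
    intro j hj
    have hc : ContinuousAt (φ j) z := (φ j).continuous.continuousAt
    rcases lt_or_gt_of_ne (ho j hj) with hlt | hlt
    · filter_upwards [hc.eventually_lt_const hlt] with w hw
      exact ⟨hw.ne, iff_of_false hw.not_gt hlt.not_gt⟩
    · filter_upwards [hc.eventually_const_lt hlt] with w hw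
      exact ⟨hw.ne', iff_of_true hw hlt⟩
  filter_upwards [hV.mem_nhds hz, (Filter.eventually_all_finset J).2 h] with w hw hJ
  exact ⟨⟨hw, fun j hj => (hJ j hj).1⟩, posWalls_eq_iff.2 fun j hj => (hJ j hj).2⟩

/-- Two points off the walls lie in the same component exactly if no wall separates them: cells are
convex, and along a connected set off the walls no sign can change. -/
theorem connectedComponentIn_eq_iff (hV : Convex ℝ V) {z w : E}
    (hz : z ∈ V ∩ offWalls φ c J) (hw : w ∈ V ∩ offWalls φ c J) :
    connectedComponentIn (V ∩ offWalls φ c J) z = connectedComponentIn (V ∩ offWalls φ c J) w ↔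
      posWalls φ c J z = posWalls φ c J w := by
  constructor
  · intro h
    have hw' : w ∈ connectedComponentIn (V ∩ offWalls φ c J) z :=
      h ▸ mem_connectedComponentIn hw
    have hz' := mem_connectedComponentIn hz
    have hpre : IsPreconnected (connectedComponentIn (V ∩ offWalls φ c J) z) :=
      isPreconnected_connectedComponentIn
    have hsub := connectedComponentIn_subset (V ∩ offWalls φ c J) z
    rw [posWalls_eq_iff]
    intro j hj
    by_contra hne
    -- otherwise `φ j` would take the value `c j` on the component
    have hmem : c j ∈ φ j '' connectedComponentIn (V ∩ offWalls φ c J) z := by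
      by_cases hcz : c j < φ j z
      · have : φ j w ≤ c j := not_lt.1 fun h => hne (by simp [hcz, h])
        exact hpre.intermediate_value hw' hz' (φ j).continuous.continuousOn ⟨this, hcz.le⟩
      · have : c j < φ j w := by
          by_contra h'
          exact hne (by simp [hcz, h'])
        exact hpre.intermediate_value hz' hw' (φ j).continuous.continuousOn
          ⟨not_lt.1 hcz, this.le⟩
    obtain ⟨y, hy, hyc⟩ := hmem
    exact (hsub hy).2 j hj hyc
  · intro h
    have hcell := (convex_cell (φ := φ) (c := c) (J := J) hV z).isPreconnected
    refine connectedComponentIn_eq ?_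
    exact hcell.subset_connectedComponentIn ⟨hz, rfl⟩ (fun y hy => hy.1) ⟨hw, h.symm⟩

theorem ncard_components_eq (hV : Convex ℝ V) :
    Set.ncard {U : Set E | ∃ z ∈ V ∩ offWalls φ c J,
        U = connectedComponentIn (V ∩ offWalls φ c J) z} =
      (posWalls φ c J '' (V ∩ offWalls φ c J)).ncard := by
  have hcell : ∀ z ∈ V ∩ offWalls φ c J,
      {w | w ∈ V ∩ offWalls φ c J ∧ posWalls φ c J w = posWalls φ c J z} =
        connectedComponentIn (V ∩ offWalls φ c J) z := by
    intro z hz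
    ext w
    constructor
    · rintro ⟨hw, h⟩
      rw [(connectedComponentIn_eq_iff hV hz hw).2 h.symm]
      exact mem_connectedComponentIn hw
    · intro hw
      have hw' := connectedComponentIn_subset _ _ hw
      exact ⟨hw', ((connectedComponentIn_eq_iff hV hz hw').1 (connectedComponentIn_eq hw)).symm⟩
  symm
  refine Set.ncard_congr
    (fun σ _ => {w | w ∈ V ∩ offWalls φ c J ∧ posWalls φ c J w = σ}) ?_ ?_ ?_
  · rintro _ ⟨z, hz, rfl⟩
    exact ⟨z, hz, hcell z hz⟩
  · rintro _ _ ⟨z, hz, rfl⟩ ⟨w, hw, rfl⟩ h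
    exact (h ▸ (⟨hz, rfl⟩ : z ∈ {y | y ∈ V ∩ offWalls φ c J ∧
      posWalls φ c J y = posWalls φ c J z}) : z ∈ {y | y ∈ V ∩ offWalls φ c J ∧
      posWalls φ c J y = posWalls φ c J w}).2
  · rintro _ ⟨z, hz, rfl⟩
    exact ⟨_, ⟨z, hz, rfl⟩, hcell z hz⟩

/-- A new wall adds as many cells as there are old cells that it meets: these are cut in two, the
others lie on one side of the new wall. -/
theorem ncard_posWalls_insert [DecidableEq ι] (hVo : IsOpen V) (hVc : Convex ℝ V) {a : ι}
    (ha : a ∉ J) (hφ : ∀ z ∈ V, φ a z = c a → φ a ≠ 0) :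
    (posWalls φ c (insert a J) '' (V ∩ offWalls φ c (insert a J))).ncard =
      (posWalls φ c J '' (V ∩ offWalls φ c J)).ncard +
        (posWalls φ c J '' (V ∩ offWalls φ c J ∩ {z | φ a z = c a})).ncard := by
  set W := V ∩ offWalls φ c J with hW
  set P := posWalls φ c J '' (W ∩ {z | c a < φ a z}) with hP
  set N := posWalls φ c J '' (W ∩ {z | φ a z < c a}) with hN
  have hPf : P.Finite := finite_image_posWalls _
  have hNf : N.Finite := finite_image_posWalls _
  have haP : ∀ z, a ∉ posWalls φ c J z := fun z h => ha (Finset.mem_filter.1 h).1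
  -- a point on the new wall can be moved to either side within its cell
  have push : ∀ z ∈ W, φ a z = c a → posWalls φ c J z ∈ P ∩ N := by
    rintro z ⟨hzV, hzo⟩ hza
    obtain ⟨v, hv⟩ : ∃ v, φ a v ≠ 0 := by
      by_contra! h
      exact hφ z hzV hza (ContinuousLinearMap.ext h)
    have cont : Continuous fun t : ℝ => z + (t * φ a v) • v := by fun_prop
    have ev := (cont.tendsto' 0 z (by simp)).eventually (eventually_mem_cell hVo hzV hzo)
    have val : ∀ t : ℝ, φ a (z + (t * φ a v) • v) = c a + t * (φ a v * φ a v) := by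
      intro t
      simp only [map_add, map_smul, smul_eq_mul, hza]
      ring
    have hpos : 0 < φ a v * φ a v := mul_self_pos.2 hv
    obtain ⟨t, ht, ht0⟩ := ((ev.filter_mono nhdsWithin_le_nhds).and
      (self_mem_nhdsWithin (s := Set.Ioi (0 : ℝ)))).exists
    obtain ⟨s, hs, hs0⟩ := ((ev.filter_mono nhdsWithin_le_nhds).and
      (self_mem_nhdsWithin (s := Set.Iio (0 : ℝ)))).exists
    refine ⟨⟨_, ⟨ht.1, ?_⟩, ht.2⟩, ⟨_, ⟨hs.1, ?_⟩, hs.2⟩⟩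
    · have := mul_pos (Set.mem_Ioi.1 ht0) hpos
      simp only [Set.mem_ofPred_eq, val]
      linarith
    · have := mul_neg_of_neg_of_pos (Set.mem_Iio.1 hs0) hpos
      simp only [Set.mem_ofPred_eq, val]
      linarith
  have hunion : posWalls φ c J '' W = P ∪ N := by
    apply Set.Subset.antisymm
    · rintro _ ⟨z, hz, rfl⟩
      rcases lt_trichotomy (φ a z) (c a) with h | h | h
      · exact Or.inr ⟨z, ⟨hz, h⟩, rfl⟩
      · exact Or.inl (push z hz h).1
      · exact Or.inl ⟨z, ⟨hz, h⟩, rfl⟩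
    · rintro _ (⟨z, hz, rfl⟩ | ⟨z, hz, rfl⟩) <;> exact ⟨z, hz.1, rfl⟩
  have hinter : posWalls φ c J '' (W ∩ {z | φ a z = c a}) = P ∩ N := by
    apply Set.Subset.antisymm
    · rintro _ ⟨z, hz, rfl⟩
      exact push z hz.1 hz.2
    · rintro _ ⟨⟨z, ⟨hz, hzp⟩, rfl⟩, ⟨w, ⟨hw, hwn⟩, hwz⟩⟩
      have hcell := convex_cell (φ := φ) (c := c) (J := J) hVc z
      obtain ⟨y, hy, hya⟩ := hcell.isPreconnected.intermediate_value (f := φ a)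
        ⟨hw, hwz⟩ ⟨hz, rfl⟩ (φ a).continuous.continuousOn ⟨le_of_lt hwn, le_of_lt hzp⟩
      exact ⟨y, ⟨hy.1, hya⟩, hy.2⟩
  have hsplit : posWalls φ c (insert a J) '' (V ∩ offWalls φ c (insert a J)) =
      (fun σ => insert a σ) '' P ∪ N := by
    have hins : ∀ z, c a < φ a z →
        posWalls φ c (insert a J) z = insert a (posWalls φ c J z) := fun z h => by
      simp [posWalls, Finset.filter_insert, h]
    have hnot : ∀ z, φ a z < c a →
        posWalls φ c (insert a J) z = posWalls φ c J z := fun z h => by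
      simp [posWalls, Finset.filter_insert, h.le]
    apply Set.Subset.antisymm
    · rintro _ ⟨z, ⟨hzV, hzo⟩, rfl⟩
      have hzW : z ∈ W := ⟨hzV, fun j hj => hzo j (Finset.mem_insert_of_mem hj)⟩
      rcases lt_or_gt_of_ne (hzo a (Finset.mem_insert_self _ _)) with h | h
      · exact Or.inr ⟨z, ⟨hzW, h⟩, (hnot z h).symm⟩
      · exact Or.inl ⟨_, ⟨z, ⟨hzW, h⟩, rfl⟩, (hins z h).symm⟩
    · rintro _ (⟨_, ⟨z, ⟨hz, h⟩, rfl⟩, rfl⟩ | ⟨z, ⟨hz, h⟩, rfl⟩)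
      · exact ⟨z, ⟨hz.1, Finset.forall_mem_insert .. |>.2 ⟨ne_of_gt h, hz.2⟩⟩, hins z h⟩
      · exact ⟨z, ⟨hz.1, Finset.forall_mem_insert .. |>.2 ⟨ne_of_lt h, hz.2⟩⟩, hnot z h⟩
  have hdisj : Disjoint ((fun σ => insert a σ) '' P) N := by
    rw [Set.disjoint_left]
    rintro _ ⟨_, -, rfl⟩ ⟨w, -, hw⟩
    exact haP w (hw ▸ Finset.mem_insert_self _ _)
  have hinj : Set.InjOn (fun σ : Finset ι => insert a σ) P := by
    rintro _ ⟨z, -, rfl⟩ _ ⟨w, -, rfl⟩ h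
    have := congrArg (fun σ => σ.erase a) h
    simpa [Finset.erase_insert (haP z), Finset.erase_insert (haP w)] using this
  rw [hsplit, hunion, hinter, Set.ncard_union_eq hdisj (hPf.image _) hNf,
    hinj.ncard_image, Set.ncard_union_add_ncard_inter _ _ hPf hNf]

/-- On an open interval the walls are points; if these are distinct, there is one cell more than
there are points. -/
theorem ncard_posWalls_interval {φ : ι → ℝ →L[ℝ] ℝ} {V : Set ℝ}
    (hVo : IsOpen V) (hVc : Convex ℝ V) (hne : V.Nonempty)
    (hφ : ∀ j ∈ J, ∃ t ∈ V, φ j t ≠ c j)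
    (hsep : ∀ t ∈ V, ∀ i ∈ J, ∀ j ∈ J, φ i t = c i → φ j t = c j → i = j) :
    (posWalls φ c J '' (V ∩ offWalls φ c J)).ncard =
      {j | j ∈ J ∧ ∃ t ∈ V, φ j t = c j}.ncard + 1 := by
  classical
  induction J using Finset.induction_on with
  | empty =>
    have : posWalls φ c ∅ '' (V ∩ offWalls φ c ∅) = {∅} := by
      have h1 : V ∩ offWalls φ c ∅ = V := by ext; simp [offWalls]
      have h2 : posWalls φ c ∅ = fun _ => ∅ := by ext; simp [posWalls]
      rw [h1, h2, hne.image_const]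
    rw [this]
    simp
  | insert a J ha ih =>
    have hφa : ∀ t ∈ V, φ a t = c a → φ a ≠ 0 := by
      intro t _ h h0
      obtain ⟨s, -, hs⟩ := hφ a (Finset.mem_insert_self _ _)
      rw [h0] at h hs
      exact hs (by simpa using h)
    rw [ncard_posWalls_insert hVo hVc ha hφa,
      ih (fun j hj => hφ j (Finset.mem_insert_of_mem hj)) fun t ht i hi j hj =>
        hsep t ht i (Finset.mem_insert_of_mem hi) j (Finset.mem_insert_of_mem hj)]
    have hfin : {j | j ∈ J ∧ ∃ t ∈ V, φ j t = c j}.Finite :=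
      (Finset.finite_toSet J).subset fun j hj => hj.1
    by_cases hex : ∃ t ∈ V, φ a t = c a
    · obtain ⟨t, ht, hta⟩ := hex
      have hset : {j | j ∈ insert a J ∧ ∃ t ∈ V, φ j t = c j} =
          insert a {j | j ∈ J ∧ ∃ t ∈ V, φ j t = c j} := by
        ext j
        simp only [Finset.mem_insert, Set.mem_ofPred_eq, Set.mem_insert_iff]
        constructor
        · rintro ⟨rfl | h, h'⟩
          · exact Or.inl rfl
          · exact Or.inr ⟨h, h'⟩
        · rintro (rfl | ⟨h, h'⟩)
          · exact ⟨Or.inl rfl, t, ht, hta⟩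
          · exact ⟨Or.inr h, h'⟩
      have hone : V ∩ offWalls φ c J ∩ {s | φ a s = c a} = {t} := by
        apply Set.eq_singleton_iff_unique_mem.2
        refine ⟨⟨⟨ht, fun j hj h => ?_⟩, hta⟩, ?_⟩
        · exact ha (hsep t ht a (Finset.mem_insert_self _ _) j (Finset.mem_insert_of_mem hj)
            hta h ▸ hj)
        · rintro s ⟨-, hs⟩
          have lin : ∀ x : ℝ, φ a x = x * φ a 1 := fun x => by
            simpa using (φ a).map_smul x 1
          have h1 : φ a 1 ≠ 0 := by
            intro h0
            refine hφa t ht hta (ContinuousLinearMap.ext fun x => ?_)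
            rw [lin x, h0, mul_zero]
            rfl
          have hs' : φ a s = φ a t := (show φ a s = c a from hs).trans hta.symm
          rw [lin s, lin t] at hs'
          exact mul_right_cancel₀ h1 hs'
      rw [hset, Set.ncard_insert_of_notMem (fun h => ha h.1) hfin, hone, Set.image_singleton,
        Set.ncard_singleton]
    · have hset : {j | j ∈ insert a J ∧ ∃ t ∈ V, φ j t = c j} =
          {j | j ∈ J ∧ ∃ t ∈ V, φ j t = c j} := by
        ext j
        simp only [Finset.mem_insert, Set.mem_ofPred_eq]
        constructor
        · rintro ⟨rfl | h, h'⟩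
          · exact absurd h' hex
          · exact ⟨h, h'⟩
        · rintro ⟨h, h'⟩
          exact ⟨Or.inr h, h'⟩
      have hnone : V ∩ offWalls φ c J ∩ {s | φ a s = c a} = ∅ := by
        ext s
        simp only [Set.mem_inter_iff, Set.mem_ofPred_eq, Set.mem_empty_iff_false, iff_false]
        rintro ⟨⟨hs, -⟩, hsa⟩
        exact hex ⟨s, hs, hsa⟩
      rw [hset, hnone, Set.image_empty, Set.ncard_empty, add_zero]

/-- If the new wall is a segment that meets the old walls in distinct points, the old walls
decompose it into one piece more than there are old walls crossing it, and each piece cuts one old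
cell in two. -/
theorem ncard_posWalls_insert_segment [DecidableEq ι] (hVo : IsOpen V) (hVc : Convex ℝ V) {a : ι}
    (ha : a ∉ J) (hφa : φ a ≠ 0) {x y : E} (hseg : V ∩ {z | φ a z = c a} = openSegment ℝ x y)
    (hφ : ∀ j ∈ J, ∃ z ∈ openSegment ℝ x y, φ j z ≠ c j)
    (hsep : ∀ z ∈ openSegment ℝ x y, ∀ i ∈ J, ∀ j ∈ J, φ i z = c i → φ j z = c j → i = j) :
    (posWalls φ c (insert a J) '' (V ∩ offWalls φ c (insert a J))).ncard =
      (posWalls φ c J '' (V ∩ offWalls φ c J)).ncard +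
        ({j | j ∈ J ∧ ∃ z ∈ openSegment ℝ x y, φ j z = c j}.ncard + 1) := by
  rw [ncard_posWalls_insert hVo hVc ha fun _ _ _ => hφa]
  congr 1
  -- the walls, pulled back along the parametrization `t ↦ x + t (y - x)` of the segment
  let ψ : ι → ℝ →L[ℝ] ℝ := fun j => (ContinuousLinearMap.id ℝ ℝ).smulRight (φ j (y - x))
  let d : ι → ℝ := fun j => c j - φ j x
  let g : ℝ → E := fun t => x + t • (y - x)
  have hg : openSegment ℝ x y = g '' Set.Ioo 0 1 := openSegment_eq_image' ℝ x y
  have hval : ∀ j t, ψ j t - d j = φ j (g t) - c j := by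
    intro j t
    simp only [ψ, d, g, map_add, map_smul, smul_eq_mul, ContinuousLinearMap.smulRight_apply,
      ContinuousLinearMap.id_apply]
    ring
  have heq : ∀ j t, ψ j t = d j ↔ φ j (g t) = c j := fun j t => by
    rw [← sub_eq_zero, hval, sub_eq_zero]
  have hlt : ∀ j t, d j < ψ j t ↔ c j < φ j (g t) := fun j t => by
    rw [← sub_pos, hval, sub_pos]
  have hoff : ∀ t, t ∈ offWalls ψ d J ↔ g t ∈ offWalls φ c J := fun t => by
    simp only [offWalls, Set.mem_ofPred_eq, ne_eq, heq]
  have hpos : ∀ t, posWalls ψ d J t = posWalls φ c J (g t) := fun t => by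
    simp only [posWalls, hlt]
  have himage : posWalls φ c J '' (V ∩ offWalls φ c J ∩ {z | φ a z = c a}) =
      posWalls ψ d J '' (Set.Ioo 0 1 ∩ offWalls ψ d J) := by
    rw [Set.inter_right_comm, hseg, hg]
    ext σ
    constructor
    · rintro ⟨_, ⟨⟨t, ht, rfl⟩, ho⟩, rfl⟩
      exact ⟨t, ⟨ht, (hoff t).2 ho⟩, hpos t⟩
    · rintro ⟨t, ⟨ht, ho⟩, rfl⟩
      exact ⟨g t, ⟨⟨t, ht, rfl⟩, (hoff t).1 ho⟩, (hpos t).symm⟩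
  rw [hg] at hφ hsep ⊢
  rw [himage, ncard_posWalls_interval isOpen_Ioo (convex_Ioo 0 1) ⟨1 / 2, by norm_num⟩]
  · simp only [heq, Set.exists_mem_image]
  · intro j hj
    obtain ⟨_, ⟨t, ht, rfl⟩, h⟩ := hφ j hj
    exact ⟨t, ht, fun h' => h ((heq j t).1 h')⟩
  · intro t ht i hi j hj h₁ h₂
    exact hsep (g t) ⟨t, ht, rfl⟩ i hi j hj ((heq i t).1 h₁) ((heq j t).1 h₂)

end Arrangement

/-! ### Lines at equal distance from the centre -/

/-- Two lines at the same distance `d > 0` from the origin, with unit normals `u` and `v`, meet in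
the ball of radius `R` exactly if `⟪u, v⟫` is large enough: their common point closest
to the origin is a multiple of `u + v`. -/
theorem exists_mem_ball_inner_eq_iff {F : Type*} [NormedAddCommGroup F] [InnerProductSpace ℝ F]
    {u v : F} (hu : ‖u‖ = 1) (hv : ‖v‖ = 1) {d R : ℝ} (hd : 0 < d) (hR : 0 < R) :
    (∃ z ∈ Metric.ball (0 : F) R, inner ℝ u z = d ∧ inner ℝ v z = d) ↔
      2 * d ^ 2 < R ^ 2 * (1 + inner ℝ u v) := by
  have hsq : ‖u + v‖ ^ 2 = 2 * (1 + inner ℝ u v) := by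
    rw [norm_add_sq_real, hu, hv]
    ring
  constructor
  · rintro ⟨z, hz, h₁, h₂⟩
    have hz' : ‖z‖ < R := mem_ball_zero_iff.1 hz
    have hle := real_inner_le_norm (u + v) z
    rw [inner_add_left, h₁, h₂] at hle
    have hpos : 0 < ‖u + v‖ := by
      by_contra h
      have : ‖u + v‖ = 0 := le_antisymm (not_lt.1 h) (norm_nonneg _)
      rw [this] at hle
      linarith
    have hlt : d + d < ‖u + v‖ * R := hle.trans_lt (mul_lt_mul_of_pos_left hz' hpos)
    have := pow_lt_pow_left₀ hlt (by positivity) two_ne_zero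
    rw [mul_pow, hsq] at this
    linarith
  · intro h
    have hpos : 0 < 1 + inner ℝ u v := by
      by_contra h'
      have := mul_nonpos_of_nonneg_of_nonpos (sq_nonneg R) (not_lt.1 h')
      nlinarith [sq_nonneg d]
    have hpos' := hpos.ne'
    refine ⟨(d / (1 + inner ℝ u v)) • (u + v), ?_, ?_, ?_⟩
    · rw [mem_ball_zero_iff]
      refine lt_of_pow_lt_pow_left₀ 2 hR.le ?_
      rw [norm_smul, mul_pow, hsq, Real.norm_eq_abs, sq_abs, div_pow]
      have : d ^ 2 / (1 + inner ℝ u v) ^ 2 * (2 * (1 + inner ℝ u v)) =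
          2 * d ^ 2 / (1 + inner ℝ u v) := by
        field_simp
      rw [this, div_lt_iff₀ hpos]
      exact h
    · rw [inner_smul_right, inner_add_right, real_inner_self_eq_norm_sq, hu]
      field_simp
    · rw [inner_smul_right, inner_add_right, real_inner_self_eq_norm_sq, hv, real_inner_comm u v]
      field_simp
      ring

/-- At most two lines at distance `d ≠ 0` from the origin pass through a given point: the unit
normals `u` of such lines satisfy the quadratic equation `z̄ u² - 2 d u + z = 0`. -/
theorem eq_or_eq_of_inner_eq {u v w z : ℂ} (hu : ‖u‖ = 1) (hv : ‖v‖ = 1) (hw : ‖w‖ = 1) {d : ℝ}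
    (hd : d ≠ 0) (h₁ : inner ℝ u z = d) (h₂ : inner ℝ v z = d) (h₃ : inner ℝ w z = d) :
    u = v ∨ u = w ∨ v = w := by
  have quad : ∀ x : ℂ, ‖x‖ = 1 → inner ℝ x z = d →
      (starRingEnd ℂ) z * x ^ 2 - 2 * d * x + z = 0 := by
    intro x hx h
    have h1 : x * (starRingEnd ℂ) x = 1 := by
      rw [Complex.mul_conj, Complex.normSq_eq_norm_sq, hx]
      norm_num
    have h2 : (2 * d : ℂ) = (starRingEnd ℂ) z * x + z * (starRingEnd ℂ) x := by
      rw [← h, Complex.inner]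
      have := Complex.add_conj (z * (starRingEnd ℂ) x)
      rw [map_mul, Complex.conj_conj] at this
      push_cast at this
      linear_combination -this
    rw [h2]
    linear_combination (-z) * h1
  have hz : (starRingEnd ℂ) z ≠ 0 := by
    intro h
    have : z = 0 := by simpa using h
    rw [this, inner_zero_right] at h₁
    exact hd h₁.symm
  have hu' := quad u hu h₁
  have hv' := quad v hv h₂
  have hw' := quad w hw h₃
  by_contra! hne
  have e₁ : (starRingEnd ℂ) z * (u + v) - 2 * d = 0 :=
    mul_left_cancel₀ (sub_ne_zero.2 hne.1) (by linear_combination hu' - hv')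
  have e₂ : (starRingEnd ℂ) z * (u + w) - 2 * d = 0 :=
    mul_left_cancel₀ (sub_ne_zero.2 hne.2.1) (by linear_combination hu' - hw')
  exact hne.2.2 (mul_left_cancel₀ hz (by linear_combination e₁ - e₂))

/-- A chord of the disc as the part of a line inside it; `u` is the unit normal of the line. -/
theorem ball_inter_line_eq_openSegment {u : ℂ} (hu : ‖u‖ = 1) {R c s : ℝ} (hR : 0 < R)
    (hs : 0 < s) (hcs : c ^ 2 + s ^ 2 = 1) :
    Metric.ball (0 : ℂ) R ∩ {z | inner ℝ u z = R * c} =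
      openSegment ℝ (R * (c - s * Complex.I) * u) (R * (c + s * Complex.I) * u) := by
  have hnorm : ∀ w : ℂ, ‖(R * w * u : ℂ)‖ ^ 2 = R ^ 2 * (w.re ^ 2 + w.im ^ 2) := by
    intro w
    rw [norm_mul, norm_mul, hu, mul_one, mul_pow, Complex.sq_norm w, Complex.normSq_apply,
      Complex.norm_real, Real.norm_eq_abs, sq_abs]
    ring
  have hinner : ∀ w : ℂ, inner ℝ u (R * w * u) = R * w.re := by
    intro w
    rw [Complex.inner, mul_assoc, Complex.mul_conj, Complex.normSq_eq_norm_sq, hu,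
      one_pow, Complex.ofReal_one, mul_one, Complex.re_ofReal_mul]
  apply Set.Subset.antisymm
  · rintro z ⟨hz, hzu⟩
    have hz' : ‖z‖ < R := mem_ball_zero_iff.1 hz
    set w : ℂ := z * (starRingEnd ℂ) u with hw
    have hzw : z = w * u := by
      rw [hw, mul_assoc, mul_comm _ u, Complex.mul_conj, Complex.normSq_eq_norm_sq, hu]
      simp
    have hre : w.re = R * c := by
      rw [← show inner ℝ u z = R * c from hzu, Complex.inner]
    have him : w.im ^ 2 < (R * s) ^ 2 := by
      have h1 : ‖w‖ < R := by
        rw [hw, norm_mul, Complex.norm_conj, hu, mul_one]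
        exact hz'
      have h2 := pow_lt_pow_left₀ h1 (norm_nonneg _) two_ne_zero
      rw [Complex.sq_norm, Complex.normSq_apply, hre] at h2
      nlinarith
    have hRs : 0 < R * s := mul_pos hR hs
    have habs := abs_lt.1 (abs_lt_of_sq_lt_sq him hRs.le)
    have hlt : -1 < w.im / (R * s) ∧ w.im / (R * s) < 1 := by
      constructor
      · rw [lt_div_iff₀ hRs]
        linarith
      · rw [div_lt_iff₀ hRs]
        linarith
    refine ⟨(1 - w.im / (R * s)) / 2, (1 + w.im / (R * s)) / 2, by linarith, by linarith,
      by ring, ?_⟩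
    have hmid : (w.im / (R * s) : ℝ) * (R * s) = w.im := div_mul_cancel₀ _ hRs.ne'
    have hmid' : ((w.im / (R * s) : ℝ) : ℂ) * (R * s) = w.im := by exact_mod_cast hmid
    have hwdec : w = R * c + w.im * Complex.I := by
      conv_lhs => rw [← Complex.re_add_im w, hre]
      push_cast
      ring
    set T : ℝ := w.im / (R * s)
    rw [hzw, Complex.real_smul, Complex.real_smul]
    conv_rhs => rw [hwdec]
    push_cast
    linear_combination (Complex.I * u) * hmid'
  · have key : ∀ σ : ℝ, σ ^ 2 = s ^ 2 →
        (R * (c + σ * Complex.I) * u : ℂ) ∈ Metric.closedBall (0 : ℂ) R ∧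
          inner ℝ u (R * (c + σ * Complex.I) * u : ℂ) = R * c := by
      intro σ hσ
      constructor
      · rw [mem_closedBall_zero_iff]
        refine le_of_eq ((sq_eq_sq₀ (norm_nonneg _) hR.le).1 ?_)
        rw [hnorm]
        simp [hσ, hcs]
      · rw [hinner]
        simp
    have h₁ := key (-s) (by ring)
    have h₂ := key s rfl
    have e : (R * (c + (-s : ℝ) * Complex.I) * u : ℂ) = R * (c - s * Complex.I) * u := by
      push_cast
      ring
    rw [e] at h₁
    have hne : (R * (c - s * Complex.I) * u : ℂ) ≠ R * (c + s * Complex.I) * u := by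
      intro h
      have hu0 : u ≠ 0 := by
        rintro rfl
        simp at hu
      have hR0 : (R : ℂ) ≠ 0 := by exact_mod_cast hR.ne'
      have := congrArg Complex.im (mul_left_cancel₀ hR0 (mul_right_cancel₀ hu0 h))
      simp at this
      linarith
    refine fun z hz => ⟨openSegment_subset_ball_of_ne h₁.1 h₂.1 hne hz, ?_⟩
    obtain ⟨a, b, -, -, hab, rfl⟩ := hz
    simp only [Set.mem_ofPred_eq, inner_add_right, inner_smul_right, h₁.2, h₂.2]
    linear_combination (R * c) * hab

/-! ### The trajectory -/

/-- The elastic reflection at a boundary point turns the incoming chord by the central angle that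
belongs to it. -/
theorem reflection_rotation {e y : ℂ} (he : ‖e‖ = 1) (hy : y ≠ 0) :
    (Submodule.span ℝ {e * y})ᗮ.reflection (e * y - y) = e * (e * y) - e * y := by
  have h1 : e * (starRingEnd ℂ) e = 1 := by
    rw [Complex.mul_conj, Complex.normSq_eq_norm_sq, he]
    norm_num
  have hy2 : ‖y‖ ^ 2 ≠ 0 := pow_ne_zero 2 (norm_ne_zero_iff.2 hy)
  have hin : inner ℝ (e * y) (e * y - y) / ‖e * y‖ ^ 2 = 1 - e.re := by
    rw [inner_sub_right, real_inner_self_eq_norm_sq, norm_mul, he, one_mul, sub_div,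
      div_self hy2]
    congr 1
    rw [Complex.inner, map_mul, mul_left_comm, Complex.mul_conj, Complex.normSq_eq_norm_sq,
      mul_comm, Complex.re_ofReal_mul, Complex.conj_re, mul_div_cancel_left₀ _ hy2]
  rw [Submodule.reflection_orthogonal_apply, Submodule.reflection_singleton_apply]
  simp only [RCLike.ofReal_real_eq_id, id]
  rw [hin]
  have hre := Complex.add_conj e
  simp only [nsmul_eq_mul, Complex.real_smul]
  push_cast at hre ⊢
  linear_combination (-e * y) * hre + y * h1

theorem eq_of_sameRay_of_norm_eq {e x z : ℂ} (he : ‖e‖ = 1) (hx : x ≠ 0) (hzx : z ≠ x)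
    (hex : e ≠ 1) (hz : ‖z‖ = ‖x‖) (h : SameRay ℝ (z - x) (e * x - x)) : z = e * x := by
  have hne : e * x - x ≠ 0 := by
    rw [← sub_one_mul]
    exact mul_ne_zero (sub_ne_zero.2 hex) hx
  obtain ⟨t, ht, htz⟩ := h.symm.exists_pos_left hne (sub_ne_zero.2 hzx)
  have hz' : z = (1 + t * (e - 1)) * x := by
    rw [Complex.real_smul] at htz
    linear_combination -htz
  have hone : ‖(1 + t * (e - 1) : ℂ)‖ = 1 := by
    rw [hz', norm_mul] at hz
    exact (mul_eq_right₀ (norm_ne_zero_iff.2 hx)).1 hz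
  have h₁ := Complex.sq_norm (1 + t * (e - 1))
  have h₂ := Complex.sq_norm e
  rw [hone, Complex.normSq_apply] at h₁
  rw [he, Complex.normSq_apply] at h₂
  simp at h₁
  have hre : e.re ≠ 1 := by
    intro h
    rw [h] at h₂
    have him : e.im = 0 := by
      have : e.im * e.im = 0 := by linarith
      simpa using this
    exact hex (Complex.ext h him)
  have hprod : (t * (e.re - 1)) * (t - 1) = 0 := by
    linear_combination (1 / 2) * h₁ - t ^ 2 / 2 * h₂
  have ht1 : t = 1 := by
    rcases mul_eq_zero.1 hprod with h | h
    · exact absurd h (mul_ne_zero ht.ne' (sub_ne_zero.2 hre))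
    · linarith
  rw [hz', ht1]
  push_cast
  ring

namespace IsBilliardTrajectory

variable {R θ : ℝ} {X : ℕ → ℂ}

theorem norm_eq (hX : IsBilliardTrajectory R θ X) (n : ℕ) : ‖X n‖ = R :=
  mem_sphere_zero_iff_norm.1 (hX.mem_circle n)

theorem ne_zero (hX : IsBilliardTrajectory R θ X) (hR : 0 < R) (n : ℕ) : X n ≠ 0 := by
  rw [← norm_ne_zero_iff, hX.norm_eq]
  exact hR.ne'

theorem succ_eq (hX : IsBilliardTrajectory R θ X) (hR : 0 < R) (n : ℕ) :
    X (n + 1) = Complex.exp (θ * Complex.I) * X n := by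
  have he : ‖Complex.exp (θ * Complex.I)‖ = 1 := Complex.norm_exp_ofReal_mul_I θ
  induction n with
  | zero => exact hX.first_angle
  | succ n ih =>
    have h := hX.elastic n
    have hstep : Complex.exp (θ * Complex.I) ≠ 1 := by
      intro h1
      exact hX.step_ne n (by rw [ih, h1, one_mul])
    refine eq_of_sameRay_of_norm_eq he (hX.ne_zero hR _) (hX.step_ne _) hstep
      ((hX.norm_eq _).trans (hX.norm_eq _).symm) ?_
    rw [ih, reflection_rotation he (hX.ne_zero hR n)] at h
    rwa [ih]

theorem eq_exp_mul (hX : IsBilliardTrajectory R θ X) (hR : 0 < R) (n : ℕ) :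
    X n = Complex.exp (((n * θ : ℝ) : ℂ) * Complex.I) * X 0 := by
  induction n with
  | zero => simp
  | succ n ih =>
    rw [hX.succ_eq hR, ih, ← mul_assoc, ← Complex.exp_add]
    congr 2
    push_cast
    ring

end IsBilliardTrajectory

/-- The unit vector that points from the centre of the disc to the midpoint of the `j`-th chord. -/
noncomputable def chordNormal (R θ : ℝ) (X : ℕ → ℂ) (j : ℕ) : ℂ :=
  Complex.exp ((((j + 1 / 2) * θ : ℝ) : ℂ) * Complex.I) * (X 0 / R)

namespace IsBilliardTrajectory

variable {R θ : ℝ} {X : ℕ → ℂ}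

theorem norm_chordNormal (hX : IsBilliardTrajectory R θ X) (hR : 0 < R) (j : ℕ) :
    ‖chordNormal R θ X j‖ = 1 := by
  rw [chordNormal, norm_mul, Complex.norm_exp_ofReal_mul_I, norm_div, hX.norm_eq,
    Complex.norm_real, Real.norm_of_nonneg hR.le, div_self hR.ne', one_mul]

theorem inner_chordNormal (hX : IsBilliardTrajectory R θ X) (hR : 0 < R) (j n : ℕ) :
    inner ℝ (chordNormal R θ X j) (chordNormal R θ X n) = Real.cos (((n : ℝ) - j) * θ) := by
  have h0 : (X 0 / R) * (starRingEnd ℂ) (X 0 / R) = 1 := by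
    rw [Complex.mul_conj, Complex.normSq_eq_norm_sq, norm_div, hX.norm_eq,
      Complex.norm_real, Real.norm_of_nonneg hR.le, div_self hR.ne']
    norm_num
  have : chordNormal R θ X n * (starRingEnd ℂ) (chordNormal R θ X j) =
      Complex.exp (((((n : ℝ) - j) * θ : ℝ) : ℂ) * Complex.I) := by
    rw [chordNormal, chordNormal, map_mul, ← Complex.exp_conj, map_mul, Complex.conj_I,
      Complex.conj_ofReal, mul_mul_mul_comm, h0, mul_one, ← Complex.exp_add]
    congr 1
    push_cast
    ring
  rw [Complex.inner, this, Complex.exp_ofReal_mul_I_re]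

theorem eq_mul_chordNormal (hX : IsBilliardTrajectory R θ X) (hR : 0 < R) (j : ℕ) :
    X j = R * (Real.cos (θ / 2) - Real.sin (θ / 2) * Complex.I) * chordNormal R θ X j ∧
      X (j + 1) = R * (Real.cos (θ / 2) + Real.sin (θ / 2) * Complex.I) * chordNormal R θ X j := by
  have hR0 : (R : ℂ) ≠ 0 := by exact_mod_cast hR.ne'
  have h₁ : (Real.cos (θ / 2) - Real.sin (θ / 2) * Complex.I : ℂ) =
      Complex.exp (((-(θ / 2) : ℝ) : ℂ) * Complex.I) := by
    rw [Complex.exp_mul_I, ← Complex.ofReal_cos, ← Complex.ofReal_sin, Real.cos_neg, Real.sin_neg]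
    push_cast
    ring
  have h₂ : (Real.cos (θ / 2) + Real.sin (θ / 2) * Complex.I : ℂ) =
      Complex.exp (((θ / 2 : ℝ) : ℂ) * Complex.I) := by
    rw [Complex.exp_mul_I, ← Complex.ofReal_cos, ← Complex.ofReal_sin]
  have hprod : ∀ a b : ℝ, (R : ℂ) * Complex.exp (a * Complex.I) *
      (Complex.exp (b * Complex.I) * (X 0 / R)) =
        Complex.exp (((a + b : ℝ) : ℂ) * Complex.I) * X 0 := by
    intro a b
    rw [Complex.ofReal_add, add_mul, Complex.exp_add]
    field_simp
  rw [h₁, h₂, hX.eq_exp_mul hR j, hX.eq_exp_mul hR (j + 1), chordNormal, hprod, hprod]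
  constructor
  · congr 4
    ring
  · congr 4
    push_cast
    ring

theorem openSegment_eq (hX : IsBilliardTrajectory R θ X) (hR : 0 < R) (hs : 0 < Real.sin (θ / 2))
    (j : ℕ) : openSegment ℝ (X j) (X (j + 1)) = Metric.ball (0 : ℂ) R ∩
      {z | inner ℝ (chordNormal R θ X j) z = R * Real.cos (θ / 2)} := by
  rw [ball_inter_line_eq_openSegment (hX.norm_chordNormal hR j) hR hs
    (Real.cos_sq_add_sin_sq _), ← (hX.eq_mul_chordNormal hR j).1, ← (hX.eq_mul_chordNormal hR j).2]

theorem uncovered_eq (hX : IsBilliardTrajectory R θ X) (hR : 0 < R) (hs : 0 < Real.sin (θ / 2))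
    (n : ℕ) : uncovered R X n = Metric.ball (0 : ℂ) R ∩
      offWalls (fun j => innerSL ℝ (chordNormal R θ X j)) (fun _ => R * Real.cos (θ / 2))
        (Finset.range n) := by
  ext z
  simp only [uncovered, offWalls, Set.mem_sdiff, Set.mem_iUnion, Set.mem_inter_iff, not_exists,
    Set.mem_ofPred_eq, innerSL_apply_apply]
  refine and_congr_right fun hz => forall₂_congr fun j _ => not_congr ?_
  have hend : ∀ i, X i ≠ z := by
    rintro i rfl
    rw [mem_ball_zero_iff, hX.norm_eq] at hz
    exact lt_irrefl _ hz
  rw [← insert_endpoints_openSegment, hX.openSegment_eq hR hs]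
  simp [(hend j).symm, (hend (j + 1)).symm, mem_ball_zero_iff.1 hz]

theorem crosses_iff (hX : IsBilliardTrajectory R θ X) (hR : 0 < R) (hs : 0 < Real.sin (θ / 2))
    (hc : 0 < Real.cos (θ / 2)) (j n : ℕ) :
    (openSegment ℝ (X j) (X (j + 1)) ∩ openSegment ℝ (X n) (X (n + 1))).Nonempty ↔
      Real.cos θ < Real.cos (((n : ℝ) - j) * θ) := by
  have h := exists_mem_ball_inner_eq_iff (hX.norm_chordNormal hR j) (hX.norm_chordNormal hR n)
    (mul_pos hR hc) hR
  rw [hX.inner_chordNormal hR] at h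
  have hcos : Real.cos θ = 2 * Real.cos (θ / 2) ^ 2 - 1 := by
    rw [← Real.cos_two_mul]
    congr 1
    ring
  have hiff : 2 * (R * Real.cos (θ / 2)) ^ 2 < R ^ 2 * (1 + Real.cos (((n : ℝ) - j) * θ)) ↔
      Real.cos θ < Real.cos (((n : ℝ) - j) * θ) := by
    rw [show 2 * (R * Real.cos (θ / 2)) ^ 2 = R ^ 2 * (1 + Real.cos θ) by rw [hcos]; ring,
      mul_lt_mul_iff_right₀ (pow_pos hR 2)]
    constructor <;> intro h <;> linarith
  rw [← hiff, ← h, hX.openSegment_eq hR hs, hX.openSegment_eq hR hs]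
  constructor
  · rintro ⟨z, ⟨hz, h₁⟩, -, h₂⟩
    exact ⟨z, hz, h₁, h₂⟩
  · rintro ⟨z, hz, h₁, h₂⟩
    exact ⟨z, ⟨hz, h₁⟩, hz, h₂⟩

theorem regionCount_zero (hX : IsBilliardTrajectory R θ X) (hR : 0 < R)
    (hs : 0 < Real.sin (θ / 2)) : regionCount R X 0 = 1 := by
  have hW : uncovered R X 0 = Metric.ball (0 : ℂ) R := by simp [uncovered]
  rw [regionCount, hX.uncovered_eq hR hs, ncard_components_eq (convex_ball 0 R),
    ← hX.uncovered_eq hR hs, hW, Finset.range_zero]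
  have : posWalls (fun j => innerSL ℝ (chordNormal R θ X j)) (fun _ => R * Real.cos (θ / 2)) ∅ =
      fun _ => ∅ := by
    ext
    simp [posWalls]
  rw [this, (Metric.nonempty_ball.2 hR).image_const, Set.ncard_singleton]

/-- As long as the chords are distinct, each chord adds one region more than the number of earlier
chords that it crosses, since no three of the chords meet in a point. -/
theorem regionCount_succ (hX : IsBilliardTrajectory R θ X) (hR : 0 < R)
    (hs : 0 < Real.sin (θ / 2)) (hc : 0 < Real.cos (θ / 2)) {n : ℕ}
    (hinj : Set.InjOn (chordNormal R θ X) (Set.Iic n)) :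
    regionCount R X (n + 1) = regionCount R X n + (crossedChords X n + 1) := by
  have hd : 0 < R * Real.cos (θ / 2) := mul_pos hR hc
  have hu := hX.norm_chordNormal hR
  have huu : ∀ j, inner ℝ (chordNormal R θ X j) (chordNormal R θ X j) = 1 := fun j => by
    rw [real_inner_self_eq_norm_sq, hu, one_pow]
  have hseg := fun j => hX.openSegment_eq hR hs j
  rw [regionCount, regionCount, hX.uncovered_eq hR hs, hX.uncovered_eq hR hs,
    ncard_components_eq (convex_ball 0 R), ncard_components_eq (convex_ball 0 R),
    Finset.range_add_one,
    ncard_posWalls_insert_segment Metric.isOpen_ball (convex_ball 0 R) Finset.notMem_range_self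
      (x := X n) (y := X (n + 1))]
  · congr 3
    ext j
    simp only [Set.mem_ofPred_eq, Finset.mem_range, innerSL_apply_apply, hseg]
    refine and_congr_right fun _ => ⟨?_, ?_⟩
    · rintro ⟨z, ⟨hz, h₁⟩, h₂⟩
      exact ⟨z, ⟨hz, h₂⟩, hz, h₁⟩
    · rintro ⟨z, ⟨hz, h₂⟩, -, h₁⟩
      exact ⟨z, ⟨hz, h₁⟩, h₂⟩
  · intro h
    have := congrArg (fun f => f (chordNormal R θ X n)) h
    rw [innerSL_apply_apply, huu] at this
    exact one_ne_zero this
  · simp only [innerSL_apply_apply]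
    exact (hseg n).symm
  · -- the midpoint of the new chord lies on no other line at the same distance from the centre
    intro j hj
    refine ⟨(R * Real.cos (θ / 2)) • chordNormal R θ X n, ?_, ?_⟩
    · rw [hseg]
      constructor
      · rw [mem_ball_zero_iff, norm_smul, hu, mul_one, Real.norm_of_nonneg hd.le]
        have : Real.cos (θ / 2) < 1 := by
          nlinarith [Real.cos_sq_add_sin_sq (θ / 2), pow_pos hs 2]
        exact mul_lt_of_lt_one_right hR this
      · simp only [Set.mem_ofPred_eq, inner_smul_right, huu, mul_one]
    · rw [innerSL_apply_apply, inner_smul_right]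
      intro h
      have h1 : inner ℝ (chordNormal R θ X j) (chordNormal R θ X n) = 1 :=
        mul_left_cancel₀ hd.ne' (by rw [h, mul_one])
      have hjn := hinj (Finset.mem_range.1 hj).le (Set.mem_Iic.2 le_rfl)
        ((inner_eq_one_iff_of_norm_eq_one (hu j) (hu n)).1 h1)
      exact (Finset.mem_range.1 hj).ne hjn
  · intro z hz i hi j hj h₁ h₂
    rw [hseg] at hz
    rw [Finset.mem_range] at hi hj
    rcases eq_or_eq_of_inner_eq (hu i) (hu j) (hu n) hd.ne' h₁ h₂ hz.2 with h | h | h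
    · exact hinj hi.le hj.le h
    · exact absurd (hinj hi.le (Set.mem_Iic.2 le_rfl) h) hi.ne
    · exact absurd (hinj hj.le (Set.mem_Iic.2 le_rfl) h) hj.ne

end IsBilliardTrajectory

/-! ### The passages of the initial point -/

section Passages

variable {p q m r : ℕ}

theorem roundEnd_eq_div (hp : 0 < p) (hq : q = m * p + r) (k : ℕ) :
    roundEnd p m r k = k * q / p := by
  rw [roundEnd, hq, mul_add, ← mul_assoc, add_comm (k * m * p), Nat.add_mul_div_right _ _ hp,
    add_comm]

theorem roundEnd_self (hp : 0 < p) (hq : q = m * p + r) : roundEnd p m r p = q := by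
  rw [roundEnd_eq_div hp hq, Nat.mul_div_cancel_left _ hp]

theorem roundEnd_one (hr : r < p) : roundEnd p m r 1 = m := by
  rw [roundEnd, one_mul, one_mul, Nat.div_eq_of_lt hr, add_zero]

theorem roundEnd_add_le (k : ℕ) : roundEnd p m r k + m ≤ roundEnd p m r (k + 1) := by
  have : k * r / p ≤ (k + 1) * r / p :=
    Nat.div_le_div_right (Nat.mul_le_mul_right _ k.le_succ)
  rw [roundEnd, roundEnd, Nat.succ_mul]
  omega

theorem strictMono_roundEnd (hm : 0 < m) : StrictMono (roundEnd p m r) :=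
  strictMono_nat_of_lt_succ fun k => by
    have := roundEnd_add_le (p := p) (m := m) (r := r) k
    omega

/-- For `1 ≤ k < p` the point `k q` of the line lies strictly between `n p` and `(n + 1) p` for
exactly one `n`, because `p` does not divide `k q`. -/
theorem eq_roundEnd_iff (hpq : p.Coprime q) (hp : 0 < p) (hq : q = m * p + r) {k : ℕ}
    (hk : 1 ≤ k) (hkp : k < p) {n : ℕ} :
    n = roundEnd p m r k ↔ n * p < k * q ∧ k * q < n * p + p := by
  rw [roundEnd_eq_div hp hq]
  constructor
  · rintro rfl
    refine ⟨lt_of_le_of_ne (Nat.div_mul_le_self _ _) fun h => ?_, Nat.lt_div_mul_add hp⟩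
    have hdvd : p ∣ k * q := Dvd.intro_left _ h
    exact absurd (Nat.le_of_dvd hk (hpq.dvd_of_dvd_mul_right hdvd)) (by omega)
  · rintro ⟨h₁, h₂⟩
    symm
    exact Nat.div_eq_of_lt_le h₁.le (by rw [Nat.succ_mul]; exact h₂)

theorem two_mul_sum_roundEnd (hpq : p.Coprime q) (hp : 0 < p) (hlt : 2 * p < q)
    (hq : q = m * p + r) :
    2 * ∑ k ∈ Finset.Ico 1 p, roundEnd p m r k = (p - 1) * (q - 1) := by
  have hrefl : ∑ k ∈ Finset.Ico 1 p, roundEnd p m r (p - k) =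
      ∑ k ∈ Finset.Ico 1 p, roundEnd p m r k := by
    have := Finset.sum_Ico_reflect (roundEnd p m r) 1 (m := p) (n := p) (by omega)
    simpa using this
  have hpair : ∀ k ∈ Finset.Ico 1 p, roundEnd p m r k + roundEnd p m r (p - k) = q - 1 := by
    intro k hk
    rw [Finset.mem_Ico] at hk
    obtain ⟨h₁, h₂⟩ := (eq_roundEnd_iff hpq hp hq hk.1 hk.2).1 rfl
    have hle : roundEnd p m r k < q := by
      by_contra! h
      have := Nat.mul_le_mul h (le_refl p)
      have := Nat.mul_lt_mul_of_pos_right hk.2 (show 0 < q by omega)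
      rw [mul_comm q p] at *
      omega
    obtain ⟨l, hl⟩ : ∃ l, p = k + l := ⟨p - k, by omega⟩
    obtain ⟨N, hN⟩ : ∃ N, q = roundEnd p m r k + N + 1 := ⟨q - 1 - roundEnd p m r k, by omega⟩
    have hpk : p - k = l := by omega
    have e₁ : p * q = k * q + l * q := by rw [← add_mul, ← hl]
    have e₂ : q * p = roundEnd p m r k * p + N * p + p := by
      nth_rw 1 [hN]
      ring
    rw [mul_comm q p] at e₂
    have hN' := (eq_roundEnd_iff (n := N) (k := l) hpq hp hq (by omega) (by omega)).2
      ⟨by omega, by omega⟩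
    rw [hpk, ← hN']
    omega
  rw [two_mul]
  nth_rw 2 [← hrefl]
  rw [← Finset.sum_add_distrib, Finset.sum_congr rfl hpair]
  simp

end Passages

theorem cos_lt_cos_iff_exists_int {θ : ℝ} (h₀ : 0 ≤ θ) (hπ : θ < Real.pi) (x : ℝ) :
    Real.cos θ < Real.cos x ↔ ∃ K : ℤ, |x - K * (2 * Real.pi)| < θ := by
  have hcos : ∀ K : ℤ, Real.cos |x - K * (2 * Real.pi)| = Real.cos x := fun K => by
    rw [Real.cos_abs, Real.cos_sub_int_mul_two_pi]
  constructor
  · intro h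
    refine ⟨round (x / (2 * Real.pi)), ?_⟩
    have hpi := Real.two_pi_pos
    have hle : |x - round (x / (2 * Real.pi)) * (2 * Real.pi)| ≤ Real.pi := by
      have h1 := abs_sub_round (x / (2 * Real.pi))
      have h2 : x - round (x / (2 * Real.pi)) * (2 * Real.pi) =
          (x / (2 * Real.pi) - round (x / (2 * Real.pi))) * (2 * Real.pi) := by
        field_simp
      rw [h2, abs_mul, abs_of_pos hpi]
      nlinarith
    rw [← hcos (round (x / (2 * Real.pi)))] at h
    exact (Real.strictAntiOn_cos.lt_iff_gt ⟨h₀, hπ.le⟩ ⟨abs_nonneg _, hle⟩).1 h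
  · rintro ⟨K, hK⟩
    rw [← hcos K]
    exact Real.cos_lt_cos_of_nonneg_of_le_pi (abs_nonneg _) hπ.le hK

section RationalAngle

variable {p q m r : ℕ} {R θ : ℝ} {X : ℕ → ℂ}

theorem angle_sub_eq (hq0 : 0 < q) (hθ : θ = (p : ℝ) / q * (2 * Real.pi)) (i K : ℤ) :
    (i : ℝ) * θ - K * (2 * Real.pi) = ((i * p - K * q : ℤ) : ℝ) * (2 * Real.pi / q) := by
  have : (q : ℝ) ≠ 0 := by positivity
  rw [hθ]
  push_cast
  field_simp

theorem angle_eq (hθ : θ = (p : ℝ) / q * (2 * Real.pi)) : θ = (p : ℝ) * (2 * Real.pi / q) := by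
  rw [hθ]
  ring

theorem cos_angle_lt_iff (hq0 : 0 < q) (hθ : θ = (p : ℝ) / q * (2 * Real.pi)) (h₀ : 0 ≤ θ)
    (hπ : θ < Real.pi) (i : ℤ) :
    Real.cos θ < Real.cos (i * θ) ↔ ∃ K : ℤ, |i * p - K * q| < p := by
  rw [cos_lt_cos_iff_exists_int h₀ hπ]
  refine exists_congr fun K => ?_
  have hpos : 0 < 2 * Real.pi / q := by positivity
  rw [angle_sub_eq hq0 hθ, abs_mul, abs_of_pos hpos]
  rw [angle_eq hθ, mul_lt_mul_iff_left₀ hpos]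
  exact_mod_cast Iff.rfl

/-- The criterion for the crossing of two chords that are `i` steps apart: in the orbit that starts
with the earlier one, the later chord has to pass the initial point or to be the next one after such
a passage. -/
theorem cos_angle_lt_iff_roundEnd (hpq : p.Coprime q) (hp : 0 < p) (hq : q = m * p + r)
    (hθ : θ = (p : ℝ) / q * (2 * Real.pi)) (h₀ : 0 ≤ θ) (hπ : θ < Real.pi) {i : ℕ} (hi : 0 < i)
    (hiq : i < q) :
    Real.cos θ < Real.cos (i * θ) ↔
      ∃ k, 1 ≤ k ∧ k < p ∧ (i = roundEnd p m r k ∨ i = roundEnd p m r k + 1) := by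
  have hq0 : 0 < q := by omega
  have h := cos_angle_lt_iff hq0 hθ h₀ hπ i
  rw [Int.cast_natCast] at h
  rw [h]
  constructor
  · rintro ⟨K, hK⟩
    rw [abs_lt] at hK
    have hip : p ≤ i * p := Nat.le_mul_of_pos_left p hi
    have hip' : i * p + p ≤ q * p := by
      rw [← Nat.succ_mul]
      exact Nat.mul_le_mul_right p hiq
    have hK0 : 0 < K := by
      by_contra! hneg
      have h1 : K * (q : ℤ) ≤ 0 := mul_nonpos_of_nonpos_of_nonneg hneg (by positivity)
      have h2 : (p : ℤ) ≤ i * p := by exact_mod_cast hip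
      linarith [hK.2]
    obtain ⟨k, rfl⟩ := Int.eq_ofNat_of_zero_le hK0.le
    have hk : 1 ≤ k := by exact_mod_cast hK0
    have h₁ : k * q < i * p + p := by
      have : ((k * q : ℕ) : ℤ) < ((i * p + p : ℕ) : ℤ) := by
        push_cast
        linarith [hK.1]
      exact_mod_cast this
    have h₂ : i * p < k * q + p := by
      have : ((i * p : ℕ) : ℤ) < ((k * q + p : ℕ) : ℤ) := by
        push_cast
        linarith [hK.2]
      exact_mod_cast this
    have hkp : k < p := by
      by_contra! hle
      have := Nat.mul_le_mul_right q hle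
      rw [mul_comm p q] at this
      omega
    refine ⟨k, hk, hkp, ?_⟩
    rcases lt_trichotomy (i * p) (k * q) with hlt | heq | hgt
    · exact Or.inl ((eq_roundEnd_iff hpq hp hq hk hkp).2 ⟨hlt, h₁⟩)
    · have hdvd : q ∣ i * p := ⟨k, by rw [heq, mul_comm]⟩
      exact absurd (Nat.le_of_dvd hi (hpq.symm.dvd_of_dvd_mul_right hdvd)) (by omega)
    · obtain ⟨i, rfl⟩ : ∃ j, i = j + 1 := ⟨i - 1, by omega⟩
      rw [Nat.succ_mul] at hgt h₂
      exact Or.inr (congrArg (· + 1) ((eq_roundEnd_iff hpq hp hq hk hkp).2 ⟨by omega, hgt⟩))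
  · rintro ⟨k, hk, hkp, rfl | rfl⟩
    · obtain ⟨h₁, h₂⟩ := (eq_roundEnd_iff hpq hp hq hk hkp).1 rfl
      refine ⟨k, abs_lt.2 ?_⟩
      zify at h₁ h₂
      constructor <;> linarith
    · obtain ⟨h₁, h₂⟩ := (eq_roundEnd_iff hpq hp hq hk hkp).1 rfl
      refine ⟨k, abs_lt.2 ?_⟩
      zify at h₁ h₂
      push_cast
      constructor <;> linarith

theorem sin_cos_half_angle_pos (h₀ : 0 < θ) (hπ : θ < Real.pi) :
    0 < Real.sin (θ / 2) ∧ 0 < Real.cos (θ / 2) :=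
  ⟨Real.sin_pos_of_pos_of_lt_pi (by linarith) (by linarith),
    Real.cos_pos_of_mem_Ioo ⟨by linarith, by linarith⟩⟩

theorem angle_mem_Ioo (hp : 0 < p) (hlt : 2 * p < q) (hθ : θ = (p : ℝ) / q * (2 * Real.pi)) :
    0 < θ ∧ θ < Real.pi := by
  have hq0 : (0 : ℝ) < q := by exact_mod_cast (show 0 < q by omega)
  have hp0 : (0 : ℝ) < p := by exact_mod_cast hp
  have hlt' : (2 : ℝ) * p < q := by exact_mod_cast hlt
  refine ⟨by rw [hθ]; positivity, ?_⟩
  rw [hθ, div_mul_eq_mul_div, div_lt_iff₀ hq0]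
  nlinarith [Real.pi_pos]

namespace IsBilliardTrajectory

theorem eq_zero_iff_dvd (hX : IsBilliardTrajectory R θ X) (hR : 0 < R) (hpq : p.Coprime q)
    (hq0 : 0 < q) (hθ : θ = (p : ℝ) / q * (2 * Real.pi)) (n : ℕ) : X n = X 0 ↔ q ∣ n := by
  rw [hX.eq_exp_mul hR n, mul_eq_right₀ (hX.ne_zero hR 0), Complex.exp_eq_one_iff]
  have hpos : 2 * Real.pi / q ≠ 0 := by positivity
  have key : ∀ K : ℤ, ((n * θ : ℝ) : ℂ) * Complex.I = K * (2 * Real.pi * Complex.I) ↔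
      (n : ℤ) * p = K * q := by
    intro K
    have h := angle_sub_eq hq0 hθ n K
    rw [Int.cast_natCast] at h
    rw [← sub_eq_zero (a := (n : ℤ) * p), ← Int.cast_eq_zero (α := ℝ), ← mul_eq_zero_iff_right hpos,
      ← h, sub_eq_zero, ← mul_assoc (K : ℂ), mul_left_inj' Complex.I_ne_zero]
    exact_mod_cast Iff.rfl
  simp only [key]
  constructor
  · rintro ⟨K, hK⟩
    have : (q : ℤ) ∣ ((n * p : ℕ) : ℤ) := ⟨K, by push_cast; rw [hK, mul_comm]⟩
    exact hpq.symm.dvd_of_dvd_mul_right (Int.natCast_dvd_natCast.1 this)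
  · rintro ⟨d, rfl⟩
    exact ⟨d * p, by push_cast; ring⟩

theorem passesOver_iff (hX : IsBilliardTrajectory R θ X) (hR : 0 < R) (hpq : p.Coprime q)
    (hp : 0 < p) (hq : q = m * p + r) (hθ : θ = (p : ℝ) / q * (2 * Real.pi)) {n : ℕ}
    (hn : n < q) :
    PassesOver θ X n (X 0) ↔ ∃ k, 1 ≤ k ∧ k < p ∧ n = roundEnd p m r k := by
  have hq0 : 0 < q := by omega
  have hpos : 0 < 2 * Real.pi / q := by positivity
  -- the initial point is passed when a multiple of the full angle lies in the arc swept by step `n`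
  have key : PassesOver θ X n (X 0) ↔ ∃ K : ℤ, (n : ℤ) * p < K * q ∧ K * q < n * p + p := by
    have hs : ∀ s : ℝ, X 0 = Complex.exp ((s : ℂ) * Complex.I) * X n ↔
        ∃ K : ℤ, s + n * θ = K * (2 * Real.pi) := by
      intro s
      rw [hX.eq_exp_mul hR n, ← mul_assoc, ← Complex.exp_add, eq_comm,
        mul_eq_right₀ (hX.ne_zero hR 0), Complex.exp_eq_one_iff]
      refine exists_congr fun K => ?_
      rw [← add_mul, ← mul_assoc (K : ℂ), mul_left_inj' Complex.I_ne_zero]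
      exact_mod_cast Iff.rfl
    simp only [PassesOver, hs]
    have e := fun K : ℤ => angle_sub_eq hq0 hθ n K
    simp only [Int.cast_natCast] at e
    have e' := angle_eq hθ
    constructor
    · rintro ⟨s, ⟨h₁, h₂⟩, K, hK⟩
      have hs' : s = ((K * q - n * p : ℤ) : ℝ) * (2 * Real.pi / q) := by
        have := e K
        push_cast at this ⊢
        linarith
      rw [hs'] at h₁ h₂
      rw [e', mul_lt_mul_iff_left₀ hpos] at h₂
      have h₁' : (0 : ℤ) < K * q - n * p := by
        exact_mod_cast pos_of_mul_pos_left h₁ hpos.le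
      have h₂' : K * q - n * p < (p : ℤ) := by exact_mod_cast h₂
      exact ⟨K, by linarith, by linarith⟩
    · rintro ⟨K, h₁, h₂⟩
      refine ⟨((K * q - n * p : ℤ) : ℝ) * (2 * Real.pi / q), ⟨?_, ?_⟩, K, ?_⟩
      · exact mul_pos (by exact_mod_cast sub_pos.2 h₁) hpos
      · rw [e']
        refine mul_lt_mul_of_pos_right ?_ hpos
        have : K * q - n * p < (p : ℤ) := by linarith
        exact_mod_cast this
      · have := e K
        push_cast at this ⊢
        linarith
  rw [key]
  constructor
  · rintro ⟨K, h₁, h₂⟩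
    have hK0 : 0 < K := by
      by_contra! hneg
      have h1 : K * (q : ℤ) ≤ 0 := mul_nonpos_of_nonpos_of_nonneg hneg (by positivity)
      have h2 : (0 : ℤ) ≤ n * p := by positivity
      linarith
    obtain ⟨k, rfl⟩ := Int.eq_ofNat_of_zero_le hK0.le
    have hk : 1 ≤ k := by exact_mod_cast hK0
    have h₁' : n * p < k * q := by exact_mod_cast h₁
    have h₂' : k * q < n * p + p := by exact_mod_cast h₂
    have hkp : k < p := by
      have h3 : n * p + p ≤ q * p := by
        rw [← Nat.succ_mul]
        exact Nat.mul_le_mul_right p hn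
      by_contra! hle
      have := Nat.mul_le_mul_right q hle
      rw [mul_comm p q] at this
      omega
    exact ⟨k, hk, hkp, (eq_roundEnd_iff hpq hp hq hk hkp).2 ⟨h₁', h₂'⟩⟩
  · rintro ⟨k, hk, hkp, hn⟩
    obtain ⟨h₁, h₂⟩ := (eq_roundEnd_iff hpq hp hq hk hkp).1 hn
    exact ⟨k, by exact_mod_cast h₁, by exact_mod_cast h₂⟩

theorem injOn_chordNormal (hX : IsBilliardTrajectory R θ X) (hR : 0 < R) (hpq : p.Coprime q)
    (hq0 : 0 < q) (hθ : θ = (p : ℝ) / q * (2 * Real.pi)) :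
    Set.InjOn (chordNormal R θ X) (Set.Iio q) := by
  intro i hi j hj h
  have hcos := hX.inner_chordNormal hR i j
  rw [← h, real_inner_self_eq_norm_sq, hX.norm_chordNormal hR, one_pow] at hcos
  obtain ⟨K, hK⟩ := (Real.cos_eq_one_iff _).1 hcos.symm
  have e := angle_sub_eq hq0 hθ ((j : ℤ) - i) K
  have hpos : 2 * Real.pi / q ≠ 0 := by positivity
  push_cast at e
  rw [← hK, sub_self, eq_comm, mul_eq_zero_iff_right hpos] at e
  have e' : ((j : ℤ) - i) * p = K * q := by
    have : ((j : ℤ) - i) * p - K * q = 0 := by exact_mod_cast e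
    linarith
  have hdvd : (q : ℤ) ∣ (j : ℤ) - i :=
    (Nat.isCoprime_iff_coprime.2 hpq.symm).dvd_of_dvd_mul_right ⟨K, by rw [e', mul_comm]⟩
  have hi' : i < q := hi
  have hj' : j < q := hj
  have := Int.eq_zero_of_abs_lt_dvd hdvd (abs_lt.2 ⟨by omega, by omega⟩)
  omega

/-- A chord crosses one earlier chord for each passage `N_k` up to the present step and a second one
for each passage before it: those that lie `N_k` and `N_k + 1` steps back. -/
theorem crossedChords_eq (hX : IsBilliardTrajectory R θ X) (hR : 0 < R) (hpq : p.Coprime q)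
    (hp : 0 < p) (hlt : 2 * p < q) (hq : q = m * p + r) (hm : 2 ≤ m)
    (hθ : θ = (p : ℝ) / q * (2 * Real.pi)) {n : ℕ} (hn : n < q) :
    crossedChords X n =
      ((Finset.Ico 1 p).filter fun k => roundEnd p m r k ≤ n).card +
        ((Finset.Ico 1 p).filter fun k => roundEnd p m r k < n).card := by
  obtain ⟨h₀, hπ⟩ := angle_mem_Ioo hp hlt hθ
  obtain ⟨hs, hc⟩ := sin_cos_half_angle_pos h₀ hπ
  set N := roundEnd p m r with hN
  have hmono : StrictMono N := strictMono_roundEnd (by omega)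
  have hN0 : ∀ k, 1 ≤ k → 0 < N k := fun k hk => (Nat.zero_le _).trans_lt (hmono hk)
  have hset : {j : ℕ | j < n ∧
      (openSegment ℝ (X j) (X (j + 1)) ∩ openSegment ℝ (X n) (X (n + 1))).Nonempty} =
      ((((Finset.Ico 1 p).filter fun k => N k ≤ n).image fun k => n - N k) ∪
        (((Finset.Ico 1 p).filter fun k => N k < n).image fun k => n - (N k + 1)) :
          Finset ℕ) := by
    ext j
    simp only [Finset.coe_union, Finset.coe_image, Finset.coe_filter, Finset.mem_Ico,
      Set.mem_union, Set.mem_image, Set.mem_ofPred_eq]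
    have hcross : j < n → ((openSegment ℝ (X j) (X (j + 1)) ∩
        openSegment ℝ (X n) (X (n + 1))).Nonempty ↔
        ∃ k, 1 ≤ k ∧ k < p ∧ (n - j = N k ∨ n - j = N k + 1)) := by
      intro hj
      rw [hX.crosses_iff hR hs hc, ← Nat.cast_sub hj.le]
      exact cos_angle_lt_iff_roundEnd hpq hp hq hθ h₀.le hπ (by omega) (by omega)
    constructor
    · rintro ⟨hj, h⟩
      obtain ⟨k, hk, hkp, h | h⟩ := (hcross hj).1 h
      · exact Or.inl ⟨k, ⟨⟨hk, hkp⟩, by omega⟩, by omega⟩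
      · exact Or.inr ⟨k, ⟨⟨hk, hkp⟩, by omega⟩, by omega⟩
    · rintro (⟨k, ⟨⟨hk, hkp⟩, h⟩, rfl⟩ | ⟨k, ⟨⟨hk, hkp⟩, h⟩, rfl⟩)
      · have := hN0 k hk
        exact ⟨by omega, (hcross (by omega)).2 ⟨k, hk, hkp, Or.inl (by omega)⟩⟩
      · exact ⟨by omega, (hcross (by omega)).2 ⟨k, hk, hkp, Or.inr (by omega)⟩⟩
  rw [crossedChords, hset, Set.ncard_coe_finset, Finset.card_union_of_disjoint,
    Finset.card_image_of_injOn, Finset.card_image_of_injOn]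
  · intro k hk l hl h
    have hk' := (Finset.mem_filter.1 hk).2
    have hl' := (Finset.mem_filter.1 hl).2
    simp only at h
    exact hmono.injective (by omega)
  · intro k hk l hl h
    have hk' := (Finset.mem_filter.1 hk).2
    have hl' := (Finset.mem_filter.1 hl).2
    simp only at h
    exact hmono.injective (by omega)
  · rw [Finset.disjoint_left]
    intro j hj hj'
    obtain ⟨k, hk, rfl⟩ := Finset.mem_image.1 hj
    obtain ⟨l, hl, h⟩ := Finset.mem_image.1 hj'
    have hk' := (Finset.mem_filter.1 hk).2
    have hl' := (Finset.mem_filter.1 hl).2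
    -- passages are at least two steps apart
    have hne : N k ≠ N l + 1 := by
      intro hkl
      have hlk : l < k := hmono.lt_iff_lt.1 (by omega)
      have h1 := hmono.monotone (Nat.succ_le_of_lt hlk)
      have h2 : N l + m ≤ N (l + 1) := roundEnd_add_le l
      have h3 : N (l + 1) ≤ N k := h1
      omega
    omega

end IsBilliardTrajectory

end RationalAngle

/-! ### The number of crossings and of regions -/

namespace IsBilliardTrajectory

variable {p q m r : ℕ} {R θ : ℝ} {X : ℕ → ℂ}

theorem crossedChords_eq_add (hX : IsBilliardTrajectory R θ X) (hR : 0 < R) (hpq : p.Coprime q)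
    (hp : 0 < p) (hlt : 2 * p < q) (hq : q = m * p + r) (hm : 2 ≤ m)
    (hθ : θ = (p : ℝ) / q * (2 * Real.pi)) {n a b : ℕ} (hn : n < q) (hap : a < p) (hbp : b < p)
    (ha : ∀ k, k < p → (roundEnd p m r k ≤ n ↔ k ≤ a))
    (hb : ∀ k, 1 ≤ k → k < p → (roundEnd p m r k < n ↔ k ≤ b)) :
    crossedChords X n = a + b := by
  have h₁ : (Finset.Ico 1 p).filter (fun k => roundEnd p m r k ≤ n) = Finset.Icc 1 a := by
    ext k
    simp only [Finset.mem_filter, Finset.mem_Ico, Finset.mem_Icc]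
    constructor
    · rintro ⟨⟨h1, h2⟩, h3⟩
      exact ⟨h1, (ha k h2).1 h3⟩
    · rintro ⟨h1, h2⟩
      exact ⟨⟨h1, by omega⟩, (ha k (by omega)).2 h2⟩
  have h₂ : (Finset.Ico 1 p).filter (fun k => roundEnd p m r k < n) = Finset.Icc 1 b := by
    ext k
    simp only [Finset.mem_filter, Finset.mem_Ico, Finset.mem_Icc]
    constructor
    · rintro ⟨⟨h1, h2⟩, h3⟩
      exact ⟨h1, (hb k h1 h2).1 h3⟩
    · rintro ⟨h1, h2⟩
      exact ⟨⟨h1, by omega⟩, (hb k h1 (by omega)).2 h2⟩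
  rw [hX.crossedChords_eq hR hpq hp hlt hq hm hθ hn, h₁, h₂, Nat.card_Icc, Nat.card_Icc]
  omega

theorem crossedChords_first_block (hX : IsBilliardTrajectory R θ X) (hR : 0 < R)
    (hpq : p.Coprime q) (hp : 0 < p) (hlt : 2 * p < q) (hq : q = m * p + r) (hm : 2 ≤ m)
    (hθ : θ = (p : ℝ) / q * (2 * Real.pi)) {n : ℕ} (hn : n < roundEnd p m r 1) :
    crossedChords X n = 0 := by
  have hmono : StrictMono (roundEnd p m r) := strictMono_roundEnd (by omega)
  have hle := hmono.monotone (show 1 ≤ p from hp)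
  rw [roundEnd_self hp hq] at hle
  have hlate : ∀ k, 1 ≤ k → n < roundEnd p m r k := fun k hk =>
    hn.trans_le (hmono.monotone hk)
  refine hX.crossedChords_eq_add hR hpq hp hlt hq hm hθ (a := 0) (b := 0) (by omega) hp hp ?_ ?_
  · intro k _
    constructor
    · intro h
      by_contra! hk
      exact absurd (hlate k hk) (by omega)
    · intro hk
      obtain rfl : k = 0 := by omega
      simp [roundEnd]
  · intro k hk _
    have := hlate k hk
    omega

theorem crossedChords_roundEnd (hX : IsBilliardTrajectory R θ X) (hR : 0 < R)
    (hpq : p.Coprime q) (hp : 0 < p) (hlt : 2 * p < q) (hq : q = m * p + r) (hm : 2 ≤ m)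
    (hθ : θ = (p : ℝ) / q * (2 * Real.pi)) {k : ℕ} (hk : 1 ≤ k) (hkp : k < p) :
    crossedChords X (roundEnd p m r k) = 2 * k - 1 := by
  have hmono : StrictMono (roundEnd p m r) := strictMono_roundEnd (by omega)
  have hlt' := hmono hkp
  rw [roundEnd_self hp hq] at hlt'
  rw [hX.crossedChords_eq_add hR hpq hp hlt hq hm hθ (a := k) (b := k - 1) hlt' hkp (by omega)
    (fun l _ => hmono.le_iff_le) (fun l _ _ => by rw [hmono.lt_iff_lt]; omega)]
  omega

theorem crossedChords_block (hX : IsBilliardTrajectory R θ X) (hR : 0 < R)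
    (hpq : p.Coprime q) (hp : 0 < p) (hlt : 2 * p < q) (hq : q = m * p + r) (hm : 2 ≤ m)
    (hθ : θ = (p : ℝ) / q * (2 * Real.pi)) {k : ℕ} (hkp : k < p) {n : ℕ}
    (h₁ : roundEnd p m r k < n) (h₂ : n < roundEnd p m r (k + 1)) :
    crossedChords X n = 2 * k := by
  have hmono : StrictMono (roundEnd p m r) := strictMono_roundEnd (by omega)
  have hle := hmono.monotone (show k + 1 ≤ p from hkp)
  rw [roundEnd_self hp hq] at hle
  have hiff : ∀ l, (roundEnd p m r l ≤ n ↔ l ≤ k) ∧ (roundEnd p m r l < n ↔ l ≤ k) := by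
    intro l
    rcases Nat.lt_or_ge k l with h | h
    · have := hmono.monotone (Nat.succ_le_of_lt h)
      have : n < roundEnd p m r l := h₂.trans_le this
      omega
    · have := hmono.monotone h
      omega
  rw [hX.crossedChords_eq_add hR hpq hp hlt hq hm hθ (a := k) (b := k) (by omega) hkp hkp
    (fun l _ => (hiff l).1) (fun l _ _ => (hiff l).2)]
  omega

theorem regionCount_succ_of_lt (hX : IsBilliardTrajectory R θ X) (hR : 0 < R)
    (hpq : p.Coprime q) (hp : 0 < p) (hlt : 2 * p < q) (hθ : θ = (p : ℝ) / q * (2 * Real.pi))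
    {n : ℕ} (hn : n < q) :
    regionCount R X (n + 1) = regionCount R X n + (crossedChords X n + 1) := by
  obtain ⟨h₀, hπ⟩ := angle_mem_Ioo hp hlt hθ
  obtain ⟨hs, hc⟩ := sin_cos_half_angle_pos h₀ hπ
  refine hX.regionCount_succ hR hs hc ((hX.injOn_chordNormal hR hpq (by omega) hθ).mono ?_)
  intro i hi
  exact lt_of_le_of_lt (Set.mem_Iic.1 hi) hn

end IsBilliardTrajectory

/-! ### Summation of the increments -/

section Summation

variable {f N : ℕ → ℕ} {p : ℕ}

theorem eq_add_mul_of_forall_succ {a b c : ℕ} (hab : a ≤ b)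
    (h : ∀ n, a ≤ n → n < b → f (n + 1) = f n + c) : f b = f a + (b - a) * c := by
  induction b, hab using Nat.le_induction with
  | base => simp
  | succ b hab ih =>
    rw [h b hab b.lt_succ_self, ih fun n h₁ h₂ => h n h₁ (by omega), Nat.succ_sub hab, Nat.succ_mul,
      add_assoc]

theorem apply_succ_eq_of_blocks (hN : StrictMono N)
    (hpass : ∀ k, 1 ≤ k → k < p → f (N k + 1) = f (N k) + 2 * k)
    (hblock : ∀ k, 1 ≤ k → k < p → ∀ n, N k + 1 ≤ n → n < N (k + 1) →
      f (n + 1) = f n + (2 * k + 1)) {k : ℕ} (hk : 1 ≤ k) (hkp : k < p) :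
    f (N (k + 1)) = f (N k) + (2 * k + (N (k + 1) - (N k + 1)) * (2 * k + 1)) := by
  have := hN k.lt_succ_self
  rw [eq_add_mul_of_forall_succ (Nat.succ_le_of_lt this) (hblock k hk hkp), hpass k hk hkp,
    add_assoc]

theorem apply_eq_sum_of_blocks (hN : StrictMono N) (hfirst : f (N 1) = N 1 + 1)
    (hpass : ∀ k, 1 ≤ k → k < p → f (N k + 1) = f (N k) + 2 * k)
    (hblock : ∀ k, 1 ≤ k → k < p → ∀ n, N k + 1 ≤ n → n < N (k + 1) →
      f (n + 1) = f n + (2 * k + 1)) {K : ℕ} (hK : 1 ≤ K) (hKp : K ≤ p) :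
    f (N K) = 1 + N 1 + ∑ k ∈ Finset.Icc 2 K,
      (2 * (k - 1) + (N k - (N (k - 1) + 1)) * (2 * k - 1)) := by
  induction K, hK using Nat.le_induction with
  | base => simp [hfirst, add_comm]
  | succ K hK ih =>
    rw [apply_succ_eq_of_blocks hN hpass hblock hK hKp, ih (by omega),
      Finset.sum_Icc_succ_top (by omega), add_assoc, Nat.add_sub_cancel,
      show 2 * (K + 1) - 1 = 2 * K + 1 by omega]

/-- Summation by parts turns the sum of the increments into the sum of the passages. -/
theorem apply_add_two_mul_sum_of_blocks (hN : StrictMono N) (hfirst : f (N 1) = N 1 + 1)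
    (hpass : ∀ k, 1 ≤ k → k < p → f (N k + 1) = f (N k) + 2 * k)
    (hblock : ∀ k, 1 ≤ k → k < p → ∀ n, N k + 1 ≤ n → n < N (k + 1) →
      f (n + 1) = f n + (2 * k + 1)) {k : ℕ} (hkp : k + 1 ≤ p) :
    f (N (k + 1)) + k + 2 * ∑ j ∈ Finset.Ico 1 (k + 1), N j = 1 + (2 * k + 1) * N (k + 1) := by
  induction k with
  | zero => simp [hfirst, add_comm]
  | succ k ih =>
    have ih := ih (by omega)
    obtain ⟨d, hd⟩ : ∃ d, N (k + 1 + 1) = N (k + 1) + 1 + d :=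
      ⟨N (k + 1 + 1) - (N (k + 1) + 1), by
        have : N (k + 1) < N (k + 1 + 1) := hN (k + 1).lt_succ_self
        omega⟩
    rw [apply_succ_eq_of_blocks hN hpass hblock (by omega) hkp, Finset.sum_Ico_succ_top (by omega),
      show N (k + 1 + 1) - (N (k + 1) + 1) = d by omega, hd]
    linear_combination ih

end Summation

theorem mainTheorem2
    (p q m r : ℕ) (hpq : Nat.Coprime p q) (hlt : 2 * p < q) (hq : q = m * p + r) (hr : r < p)
    (R θ : ℝ) (hR : 0 < R) (hθ : θ = (p : ℝ) / (q : ℝ) * (2 * Real.pi))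
    (X : ℕ → ℂ) (hX : IsBilliardTrajectory R θ X) :
    -- the orbit closes for the first time after `q` chords
    (∀ n, X n = X 0 ↔ q ∣ n) ∧
    -- the passages of the initial point
    (∀ n < q, PassesOver θ X n (X 0) ↔ ∃ k, 1 ≤ k ∧ k < p ∧ n = roundEnd p m r k) ∧
    -- the last block ends with the orbit
    roundEnd p m r p = q ∧
    -- the lengths of the blocks of chords between the passages
    (Finset.Ico 0 (roundEnd p m r 1)).card = m ∧
    (∀ k, 2 ≤ k → k ≤ p →
      ((Finset.Ico (roundEnd p m r (k - 1) + 1) (roundEnd p m r k)).card : ℤ)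
        = (m : ℤ) - 1 + ((k * r / p : ℕ) : ℤ) - (((k - 1) * r / p : ℕ) : ℤ)) ∧
    (∀ k, 1 ≤ k → k < p → k * r / p < r) ∧
    -- the sequence of region numbers
    regionCount R X 0 = 1 ∧
    (∀ n < roundEnd p m r 1,
      crossedChords X n = 0 ∧ regionCount R X (n + 1) = regionCount R X n + 1) ∧
    (∀ k, 1 ≤ k → k < p →
      crossedChords X (roundEnd p m r k) = 2 * k - 1 ∧
      regionCount R X (roundEnd p m r k + 1) = regionCount R X (roundEnd p m r k) + 2 * k) ∧
    (∀ k, 2 ≤ k → k ≤ p →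
      ∀ n ∈ Finset.Ico (roundEnd p m r (k - 1) + 1) (roundEnd p m r k),
        crossedChords X n = 2 * (k - 1) ∧
        regionCount R X (n + 1) = regionCount R X n + (2 * k - 1)) ∧
    -- the first values of the sequence
    regionCount R X m = m + 1 ∧
    (2 ≤ p →
      regionCount R X (m + 1) = m + 3 ∧
      (regionCount R X (2 * m + 2 * r / p) : ℤ)
        = (m : ℤ) + 3 + 3 * ((m : ℤ) - 1 + ((2 * r / p : ℕ) : ℤ) - ((r / p : ℕ) : ℤ))) ∧
    -- the total number of regions
    regionCount R X q =
      1 + (∑ _n ∈ Finset.Icc 1 (m + r / p), 1)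
        + ∑ k ∈ Finset.Icc 2 p, (2 * (k - 1)
            + ∑ _n ∈ Finset.Icc ((k - 1) * m + 2 + (k - 1) * r / p) (k * m + k * r / p),
                (2 * k - 1)) ∧
    regionCount R X q = p * q + 1 ∧
    -- the case `r = 1`
    (r = 1 →
      (∀ k, 1 ≤ k → k < p → k / p = 0) ∧
      (∀ n < q, PassesOver θ X n (X 0) ↔ ∃ k, 1 ≤ k ∧ k < p ∧ n = k * m) ∧
      (∀ n < m, regionCount R X (n + 1) = regionCount R X n + 1) ∧
      (∀ k, 1 ≤ k → k < p →
        regionCount R X (k * m + 1) = regionCount R X (k * m) + 2 * k) ∧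
      (∀ k, 2 ≤ k → k < p → ∀ i < m - 1,
        regionCount R X ((k - 1) * m + 1 + i + 1)
          = regionCount R X ((k - 1) * m + 1 + i) + (2 * k - 1)) ∧
      (∀ i < m,
        regionCount R X ((p - 1) * m + 1 + i + 1)
          = regionCount R X ((p - 1) * m + 1 + i) + (2 * p - 1)) ∧
      (3 ≤ p → regionCount R X (2 * m) = 4 * m ∧ regionCount R X (2 * m + 1) = 4 * m + 4) ∧
      regionCount R X q =
        1 + (∑ _n ∈ Finset.Icc 1 m, 1)
          + (∑ k ∈ Finset.Icc 2 (p - 1), (2 * (k - 1)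
              + ∑ _n ∈ Finset.Icc ((k - 1) * m + 2) (k * m), (2 * k - 1)))
          + (2 * (p - 1) + ∑ _n ∈ Finset.Icc ((p - 1) * m + 2) (p * m + 1), (2 * p - 1))) := by
  have hp : 0 < p := by omega
  have hq0 : 0 < q := by omega
  have hm : 2 ≤ m := by
    by_contra! h
    have : m * p ≤ 1 * p := Nat.mul_le_mul_right p (by omega)
    omega
  obtain ⟨h₀, hπ⟩ := angle_mem_Ioo hp hlt hθ
  have hN : StrictMono (roundEnd p m r) := strictMono_roundEnd (by omega)
  have hNp : roundEnd p m r p = q := roundEnd_self hp hq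
  have hN1 : roundEnd p m r 1 = m := roundEnd_one hr
  have hNle : ∀ k, k ≤ p → roundEnd p m r k ≤ q := fun k hk => hNp ▸ hN.monotone hk
  have hstep : ∀ n < q, regionCount R X (n + 1) = regionCount R X n + (crossedChords X n + 1) :=
    fun n hn => hX.regionCount_succ_of_lt hR hpq hp hlt hθ hn
  have hc1 : ∀ n < roundEnd p m r 1, crossedChords X n = 0 := fun n hn =>
    hX.crossedChords_first_block hR hpq hp hlt hq hm hθ hn
  have hc2 : ∀ k, 1 ≤ k → k < p → crossedChords X (roundEnd p m r k) = 2 * k - 1 :=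
    fun k hk hkp => hX.crossedChords_roundEnd hR hpq hp hlt hq hm hθ hk hkp
  have hc3 : ∀ k, 1 ≤ k → k < p → ∀ n, roundEnd p m r k + 1 ≤ n → n < roundEnd p m r (k + 1) →
      crossedChords X n = 2 * k := fun k _ hkp n h₁ h₂ =>
    hX.crossedChords_block hR hpq hp hlt hq hm hθ hkp h₁ h₂
  have hf0 : regionCount R X 0 = 1 := hX.regionCount_zero hR (sin_cos_half_angle_pos h₀ hπ).1
  have hf1 : ∀ n < roundEnd p m r 1, regionCount R X (n + 1) = regionCount R X n + 1 := by
    intro n hn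
    rw [hstep n (hn.trans_le (hNle 1 hp)), hc1 n hn]
  have hf2 : ∀ k, 1 ≤ k → k < p →
      regionCount R X (roundEnd p m r k + 1) = regionCount R X (roundEnd p m r k) + 2 * k := by
    intro k hk hkp
    rw [hstep _ (hNp ▸ hN hkp), hc2 k hk hkp]
    omega
  have hf3 : ∀ k, 1 ≤ k → k < p → ∀ n, roundEnd p m r k + 1 ≤ n → n < roundEnd p m r (k + 1) →
      regionCount R X (n + 1) = regionCount R X n + (2 * k + 1) := by
    intro k hk hkp n h₁ h₂
    rw [hstep n (h₂.trans_le (hNle (k + 1) hkp)), hc3 k hk hkp n h₁ h₂]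
  have hfm : regionCount R X (roundEnd p m r 1) = roundEnd p m r 1 + 1 := by
    rw [eq_add_mul_of_forall_succ (Nat.zero_le _) fun n _ h => hf1 n h, hf0]
    omega
  have hsum := fun K (h₁ : 1 ≤ K) (h₂ : K ≤ p) => apply_eq_sum_of_blocks hN hfm hf2 hf3 h₁ h₂
  have hpass := fun n (hn : n < q) => hX.passesOver_iff hR hpq hp hq hθ hn
  refine ⟨hX.eq_zero_iff_dvd hR hpq hq0 hθ, hpass, hNp, by simp [hN1], ?_, ?_, hf0,
    fun n hn => ⟨hc1 n hn, hf1 n hn⟩, fun k hk hkp => ⟨hc2 k hk hkp, hf2 k hk hkp⟩, ?_, ?_, ?_, ?_,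
    ?_, ?_⟩
  · intro k hk hkp
    obtain ⟨k, rfl⟩ : ∃ l, k = l + 1 := ⟨k - 1, by omega⟩
    have h := roundEnd_add_le (p := p) (m := m) (r := r) k
    rw [Nat.card_Ico, Nat.add_sub_cancel, Nat.cast_sub (by omega)]
    simp only [roundEnd]
    push_cast
    ring
  · intro k hk hkp
    have hr0 : 0 < r := by
      by_contra h
      obtain rfl : r = 0 := by omega
      -- `r = 0` makes `p` a divisor of `q`, so `p = 1`
      have : p = 1 := hpq.eq_one_of_dvd ⟨m, by rw [hq, add_zero, mul_comm]⟩
      omega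
    rw [Nat.div_lt_iff_lt_mul hp, mul_comm r p]
    exact Nat.mul_lt_mul_of_pos_right hkp hr0
  · intro k hk hkp n hn
    obtain ⟨k, rfl⟩ : ∃ l, k = l + 1 := ⟨k - 1, by omega⟩
    rw [Finset.mem_Ico, Nat.add_sub_cancel] at hn
    rw [Nat.add_sub_cancel, hc3 k (by omega) hkp n hn.1 hn.2, hf3 k (by omega) hkp n hn.1 hn.2]
    exact ⟨rfl, by omega⟩
  · rw [hN1] at hfm
    exact hfm
  · intro hp2
    have h1 := hf2 1 le_rfl hp2
    rw [hfm, hN1] at h1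
    refine ⟨h1, ?_⟩
    have h2 := apply_succ_eq_of_blocks hN hf2 hf3 le_rfl hp2
    have hle := hN (Nat.lt_succ_self 1)
    rw [hfm] at h2
    have e : roundEnd p m r (1 + 1) = 2 * m + 2 * r / p := rfl
    rw [e, hN1] at h2 hle
    rw [h2, Nat.div_eq_of_lt hr]
    push_cast [Nat.cast_sub (Nat.succ_le_of_lt hle)]
    ring
  · have h := hsum p hp le_rfl
    rw [hNp] at h
    rw [h, hN1, Nat.div_eq_of_lt hr]
    congr 1
    · simp
    · refine Finset.sum_congr rfl fun k hk => ?_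
      rw [Finset.sum_const, Nat.card_Icc, smul_eq_mul]
      congr 2
      simp only [roundEnd]
      omega
  · obtain ⟨k, rfl⟩ : ∃ k, p = k + 1 := ⟨p - 1, by omega⟩
    have h := apply_add_two_mul_sum_of_blocks hN hfm hf2 hf3 le_rfl
    rw [two_mul_sum_roundEnd hpq hp hlt hq, hNp, Nat.add_sub_cancel] at h
    obtain ⟨s, rfl⟩ : ∃ s, q = s + 1 := ⟨q - 1, by omega⟩
    rw [Nat.add_sub_cancel] at h
    nlinarith
  · rintro rfl
    have hNk : ∀ k, k < p → roundEnd p m 1 k = k * m := fun k hk => by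
      rw [roundEnd, mul_one, Nat.div_eq_of_lt hk, add_zero]
    refine ⟨fun k _ hk => Nat.div_eq_of_lt hk, ?_, ?_, ?_, ?_, ?_, ?_, ?_⟩
    · intro n hn
      rw [hpass n hn]
      exact exists_congr fun k => and_congr_right fun _ => and_congr_right fun hk => by
        rw [hNk k hk]
    · intro n hn
      exact hf1 n (by rwa [hN1])
    · intro k hk hkp
      have := hf2 k hk hkp
      rwa [hNk k hkp] at this
    · intro k hk hkp i hi
      obtain ⟨k, rfl⟩ : ∃ l, k = l + 1 := ⟨k - 1, by omega⟩
      rw [Nat.add_sub_cancel]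
      have h := hf3 k (by omega) (by omega) (k * m + 1 + i)
      rw [hNk k (by omega), hNk (k + 1) hkp, Nat.succ_mul] at h
      rw [h (by omega) (by omega)]
      omega
    · intro i hi
      obtain ⟨k, rfl⟩ : ∃ l, p = l + 1 := ⟨p - 1, by omega⟩
      rw [Nat.add_sub_cancel]
      have h := hf3 k (by omega) (by omega) (k * m + 1 + i)
      rw [hNk k (by omega), hNp, hq, mul_comm m, Nat.succ_mul] at h
      rw [h (by omega) (by omega)]
      omega
    · intro hp3
      have h2 := apply_succ_eq_of_blocks hN hf2 hf3 le_rfl (show 1 < p by omega)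
      have h3 := hf2 2 (by omega) hp3
      have e2 := hNk 2 hp3
      rw [show 1 + 1 = 2 from rfl, hfm, e2, hN1] at h2
      rw [e2] at h3
      omega
    · have h := hsum (p - 1) (by omega) (by omega)
      have h2 := apply_succ_eq_of_blocks hN hf2 hf3 (k := p - 1) (by omega) (by omega)
      rw [Nat.sub_add_cancel hp, hNp, h, hN1, hNk (p - 1) (by omega)] at h2
      rw [h2]
      congr 1
      · congr 1
        · simp
        · refine Finset.sum_congr rfl fun k hk => ?_
          rw [Finset.mem_Icc] at hk
          rw [Finset.sum_const, Nat.card_Icc, smul_eq_mul, hNk k (by omega),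
            hNk (k - 1) (by omega)]
          congr 2
          omega
      · rw [Finset.sum_const, Nat.card_Icc, smul_eq_mul, hq, mul_comm m p]
        congr 2
        · omega
        · omega
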